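/- Let $\mathbb K$ be an arbitrary field, let $G$ be a finite simple connected graph with vertex set $[n]=\{1,\dots,n\}$, $n\ge 1$, and let $S=\mathbb K[x_1,\dots,x_n,y_1,\dots,y_n]$ be the polynomial ring with the standard grading $\deg x_i=\deg y_i=1$. Let $$\mathcal I_G=(x_ix_j-y_iy_j : \{i,j\}\in E(G))\subset S$$ be the parity binomial edge ideal of $G$. Then $$\operatorname{reg}(S/\mathcal I_G)\ \ge\ \max\{\ell(G),\operatorname{oc}(G)\}.$$ Here $\operatorname{reg}(S/\mathcal I_G)=\max\{j-i : \beta_{i,j}(S/\mathcal I_G)\neq 0,\ i\ge 0\}$, where the graded Betti number $\beta_{i,j}(S/\mathcal I_G)$ is the number of summands $S(-j)$ in homological degree $i$ of the minimal graded free resolution of $S/\mathcal I_G$ over $S$; $\ell(G)$ is the length (number of edges) of a longest induced path of $G$; and $\operatorname{oc}(G)$ is the length of a longest induced odd cycle of $G$, with $\operatorname{oc}(G)=0$ if $G$ has no induced odd cycle. -/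

import Mathlib

open MvPolynomial

noncomputable section

/-- For the free module `F = ⨁ₖ R(-deg k)` over the standard graded polynomial ring `R = K[σ]`,
the `K`-subspace of homogeneous elements of degree `e`: the `k`-th coordinate has degree
`e - deg k` (all variables having degree `1`, and `R` being zero in negative degrees). -/
def gradedFreePart (K : Type*) [Field K] (σ : Type*) {r : ℕ} (deg : Fin r → ℤ) (e : ℤ) :
    Submodule K (Fin r → MvPolynomial σ K) :=
  Submodule.pi Set.univ
    fun k => weightedHomogeneousSubmodule K (fun _ : σ => (1 : ℤ)) (e - deg k)

/-- A minimal graded free resolution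
`⋯ → ⨁ₖ R(-deg 1 k) → ⨁ₖ R(-deg 0 k) → M → 0`
(all the free modules of finite rank, all the maps homogeneous of degree `0`) of the module `M`,
with homogeneous components `ℳ e` for `e : ℤ`, over the standard graded polynomial ring
`R = K[σ]`. -/
structure MinimalGradedFreeResolution {K : Type*} [Field K] {σ : Type*} {M : Type*}
    [AddCommGroup M] [Module K M] [Module (MvPolynomial σ K) M] (ℳ : ℤ → Submodule K M) where
  /-- the rank of the `i`-th free module -/
  rank : ℕ → ℕ
  /-- the degrees of the basis elements of the `i`-th free module -/
  deg : (i : ℕ) → Fin (rank i) → ℤ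
  /-- the differentials -/
  d : (i : ℕ) → (Fin (rank (i + 1)) → MvPolynomial σ K) →ₗ[MvPolynomial σ K]
    (Fin (rank i) → MvPolynomial σ K)
  /-- the augmentation -/
  aug : (Fin (rank 0) → MvPolynomial σ K) →ₗ[MvPolynomial σ K] M
  d_homogeneous : ∀ (i : ℕ) (e : ℤ), ∀ v ∈ gradedFreePart K σ (deg (i + 1)) e,
    d i v ∈ gradedFreePart K σ (deg i) e
  aug_homogeneous : ∀ (e : ℤ), ∀ v ∈ gradedFreePart K σ (deg 0) e, aug v ∈ ℳ e
  aug_surjective : Function.Surjective aug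
  exact_aug : Function.Exact (d 0) aug
  exact_d : ∀ i : ℕ, Function.Exact (d (i + 1)) (d i)
  /-- minimality: the image of each differential lies in `𝔪 F`, where `𝔪` is the ideal generated
  by the variables -/
  minimal : ∀ (i : ℕ) (v : Fin (rank (i + 1)) → MvPolynomial σ K) (k : Fin (rank i)),
    d i v k ∈ Ideal.span (Set.range (X : σ → MvPolynomial σ K))

/-- The graded Betti number `β_{i,j}(M)`: the number of summands `R(-j)` in homological degree
`i` of the minimal graded free resolution of `M`. That resolution exists for every finitely
generated graded module over finitely many variables and is unique up to isomorphism, so the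
choice made here does not matter. -/
def gradedBetti {K : Type*} [Field K] (σ : Type*) {M : Type*}
    [AddCommGroup M] [Module K M] [Module (MvPolynomial σ K) M] (ℳ : ℤ → Submodule K M)
    (i : ℕ) (j : ℤ) : ℕ :=
  open Classical in
  if h : Nonempty (MinimalGradedFreeResolution (σ := σ) ℳ) then
    Nat.card {k : Fin (h.some.rank i) // h.some.deg i k = j}
  else 0

/-- The Castelnuovo–Mumford regularity `reg M = max {j - i : β_{i,j}(M) ≠ 0}`. The maximum is
written as a supremum of extended reals, so that it needs no proof of boundedness to make sense
(it is `-∞` for `M = 0`). -/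
def regularity {K : Type*} [Field K] (σ : Type*) {M : Type*}
    [AddCommGroup M] [Module K M] [Module (MvPolynomial σ K) M] (ℳ : ℤ → Submodule K M) : EReal :=
  ⨆ (i : ℕ) (j : ℤ) (_ : gradedBetti σ ℳ i j ≠ 0), (((j - i : ℤ) : ℝ) : EReal)

/-- The standard grading of `R / I`, for a homogeneous ideal `I` of `R = K[σ]`. -/
def quotientGrading {K : Type*} [Field K] {σ : Type*} (I : Ideal (MvPolynomial σ K)) (e : ℤ) :
    Submodule K (MvPolynomial σ K ⧸ I) :=
  (weightedHomogeneousSubmodule K (fun _ : σ => (1 : ℤ)) e).map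
    (Ideal.Quotient.mkₐ K I).toLinearMap

/-- The parity binomial edge ideal of `G`, generated by the `xᵢxⱼ - yᵢyⱼ` for the edges `{i, j}`
of `G`, in the polynomial ring in the variables `xᵢ = X (Sum.inl i)` and `yᵢ = X (Sum.inr i)`. -/
def parityBinomialEdgeIdeal (K : Type*) [Field K] {V : Type*} (G : SimpleGraph V) :
    Ideal (MvPolynomial (V ⊕ V) K) :=
  Ideal.span {p | ∃ i j : V, G.Adj i j ∧
    p = X (Sum.inl i) * X (Sum.inl j) - X (Sum.inr i) * X (Sum.inr j)}

/-- The length (number of edges) of a longest induced path of a finite graph. -/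
def longestInducedPath {V : Type*} (G : SimpleGraph V) : ℕ :=
  sSup {k : ℕ | (SimpleGraph.pathGraph (k + 1)).IsIndContained G}

/-- The length of a longest induced odd cycle of a finite graph, and `0` if there is none. -/
def longestInducedOddCycle {V : Type*} (G : SimpleGraph V) : ℕ :=
  sSup {k : ℕ | 3 ≤ k ∧ Odd k ∧ (SimpleGraph.cycleGraph k).IsIndContained G}

end

/-! Let `H` be an induced path or induced odd cycle of `G`, with `n` edges and edge binomials `f_j`.
The claim behind the bound is `β_{n,2n} ≠ 0`, which contributes `2n - n = n` to the regularity. The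
class responsible is the product of the `n` Koszul generators attached to the `f_j`, of degree `2n`.

To see that this class survives, specialize: the variables of vertices outside `H` go to `0`, the
others to linear forms in a polynomial ring `R` in `n` variables, chosen so that the images of the
`f_j` have only the trivial common zero. The ideal of these images then contains a power of every
variable, hence a regular sequence of length `n`, so their Koszul complex over `R` is acyclic in
positive degrees (`KoszulMatrices.exists_d_smul_eq_of_isWeaklyRegular`). Since `H` is induced, the
whole ideal of `G` maps into that ideal.

For any minimal graded resolution `F`, freeness and exactness give chain maps from a Koszul-type
complex over `S` to `F` and from `F` to the Koszul complex over `R`; the composite is homotopic to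
the canonical map. Modulo the variables the homotopy terms vanish, while the canonical image of the
top product has a coordinate `1`. So the image of the top product in `F_n` is not in `𝔪 F_n`, and
`F_n` has a basis element of degree `2n` (`exists_deg_eq_of_koszulTarget`). The source need only be
free with the right differential, so the tensor algebra on words replaces the exterior algebra.

The linear forms come from a sequence `z` for which the path edges become `z (k + 1) ^ 2 - z k * z
(k + 2)` (`pathCoord_edge_mem_iff`). For a path, `z 0 = 0` forces all the terms to vanish; for an
odd cycle, a nontrivial zero with `z 0` and `z 1` nonzero is a geometric progression, which the
closing edge excludes (`forall_eq_zero_of_cycle`). -/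

noncomputable section

/-! ### Koszul complexes as iterated mapping cones. -/

/-- The Koszul complex of `f₀, …, f_{n-1}`, written in a basis indexed by a finite graded set:
the differential `d` and the exterior multiplications `e j` by the generators, as matrices. -/
structure KoszulMatrices {R : Type*} [CommRing R] {n : ℕ} (f : Fin n → R) where
  T : Type
  [fintype : Fintype T]
  [decEq : DecidableEq T]
  deg : T → ℕ
  d : Matrix T T R
  e : Fin n → Matrix T T R
  bot : T
  d_mul_d : d * d = 0
  d_mul_e : ∀ j, d * e j + e j * d = f j • (1 : Matrix T T R)
  deg_d : ∀ s t, d s t ≠ 0 → deg t = deg s + 1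
  deg_e : ∀ j s t, e j s t ≠ 0 → deg s = deg t + 1
  deg_le : ∀ t, deg t ≤ n
  deg_eq_zero : ∀ t, deg t = 0 ↔ t = bot
  d_mem : ∀ s t, d s t ∈ Ideal.span (Set.range f)
  exists_top : ∃ (a : Fin n → Fin n) (t : T), ((List.ofFn a).map e).prod t bot = 1

attribute [instance] KoszulMatrices.fintype KoszulMatrices.decEq

theorem prod_map_fromBlocks_diagonal {R T ι : Type*} [CommRing R] [Fintype T] [DecidableEq T]
    (A B : ι → Matrix T T R) (l : List ι) :
    (l.map fun j => Matrix.fromBlocks (A j) 0 0 (B j)).prod =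
      Matrix.fromBlocks (l.map A).prod 0 0 (l.map B).prod := by
  induction l with
  | nil => simp
  | cons a l ih => simp [ih, Matrix.fromBlocks_multiply]

/-- The Koszul matrices of `f₀, …, fₙ` as the mapping cone of `f₀` on those of `f₁, …, fₙ`. -/
def KoszulMatrices.cone {R : Type*} [CommRing R] {n : ℕ} (f : Fin (n + 1) → R)
    (k : KoszulMatrices fun j : Fin n => f j.succ) : KoszulMatrices f where
  T := k.T ⊕ k.T
  deg := Sum.elim k.deg fun t => k.deg t + 1
  d := Matrix.fromBlocks k.d (f 0 • 1) 0 (-k.d)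
  -- The minus sign makes the off-diagonal contributions of `f 0` to `d * e + e * d` cancel.
  e := Fin.cases (Matrix.fromBlocks 0 0 1 0) fun j => Matrix.fromBlocks (k.e j) 0 0 (-k.e j)
  bot := Sum.inl k.bot
  d_mul_d := by simp [Matrix.fromBlocks_multiply, k.d_mul_d]
  d_mul_e := by
    intro j
    cases j using Fin.cases with
    | zero =>
      simp [Matrix.fromBlocks_multiply, Matrix.fromBlocks_add, ← Matrix.fromBlocks_one,
        Matrix.fromBlocks_smul]
    | succ j =>
      simp [Matrix.fromBlocks_multiply, Matrix.fromBlocks_add, ← Matrix.fromBlocks_one,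
        Matrix.fromBlocks_smul, k.d_mul_e j]
  deg_d := by
    rintro (s | s) (t | t) h
    · exact k.deg_d s t h
    · by_cases hst : s = t
      · simp [hst]
      · simp [hst] at h
    · simp at h
    · have := k.deg_d s t (by simpa using h)
      simp [this]
  deg_e := by
    intro j
    cases j using Fin.cases with
    | zero =>
      rintro (s | s) (t | t) h
      · simp at h
      · simp at h
      · by_cases hst : s = t
        · simp [hst]
        · simp [hst] at h
      · simp at h
    | succ j =>
      rintro (s | s) (t | t) h
      · exact k.deg_e j s t h
      · simp at h
      · simp at h
      · have := k.deg_e j s t (by simpa using h)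
        simp [this]
  deg_le := by
    rintro (t | t)
    · exact (k.deg_le t).trans (Nat.le_succ n)
    · exact Nat.succ_le_succ (k.deg_le t)
  deg_eq_zero := by
    rintro (t | t)
    · simp [k.deg_eq_zero]
    · simp
  d_mem := by
    have hle : Ideal.span (Set.range fun j : Fin n => f j.succ) ≤ Ideal.span (Set.range f) :=
      Ideal.span_mono (by rintro _ ⟨j, rfl⟩; exact ⟨j.succ, rfl⟩)
    rintro (s | s) (t | t)
    · exact hle (k.d_mem s t)
    · exact Ideal.mul_mem_right _ _ (Ideal.subset_span (Set.mem_range_self 0))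
    · simp
    · simpa using hle (k.d_mem s t)
  exists_top := by
    obtain ⟨a, t, h⟩ := k.exists_top
    refine ⟨Fin.cons 0 fun j => (a j).succ, Sum.inr t, ?_⟩
    rw [List.ofFn_succ, List.map_cons, List.prod_cons]
    have := prod_map_fromBlocks_diagonal k.e (fun j => -k.e j) (List.ofFn a)
    simp only [Fin.cons_zero, Fin.cons_succ, Fin.cases_zero]
    rw [List.ofFn_comp' a Fin.succ, List.map_map]
    change ((Matrix.fromBlocks 0 0 1 0 : Matrix (k.T ⊕ k.T) (k.T ⊕ k.T) R) *
      (List.map (fun j => Matrix.fromBlocks (k.e j) 0 0 (-k.e j)) (List.ofFn a)).prod)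
        (Sum.inr t) (Sum.inl k.bot) = 1
    rw [this, Matrix.fromBlocks_multiply]
    simpa using h

theorem nonempty_koszulMatrices {R : Type*} [CommRing R] :
    ∀ {n : ℕ} (f : Fin n → R), Nonempty (KoszulMatrices f)
  | 0, f => ⟨{ T := Unit, deg := fun _ => 0, d := 0, e := fun j => j.elim0, bot := ()
               d_mul_d := by simp
               d_mul_e := fun j => j.elim0
               deg_d := by simp
               deg_e := fun j => j.elim0
               deg_le := by simp
               deg_eq_zero := by simp
               d_mem := by simp
               exists_top := ⟨Fin.elim0, (), by simp⟩ }⟩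
  | _ + 1, f => ⟨(nonempty_koszulMatrices fun j => f j.succ).some.cone f⟩

/-! ### Koszul homology with coefficients and its vanishing. -/

namespace KoszulMatrices

open scoped Matrix.Module

variable {R : Type*} [CommRing R] {n : ℕ} {f : Fin n → R} (k : KoszulMatrices f)

/-- The chains of degree `i` of the Koszul complex with coefficients in `M`. -/
def IsChain {M : Type*} [Zero M] (i : ℕ) (c : k.T → M) : Prop := ∀ t, k.deg t ≠ i → c t = 0

variable {M : Type*} [AddCommGroup M] [Module R M]

theorem d_smul_d_smul (c : k.T → M) : k.d • k.d • c = 0 := by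
  rw [← mul_smul, k.d_mul_d, zero_smul]

theorem isChain_d_smul {i : ℕ} {c : k.T → M} (hc : k.IsChain (i + 1) c) :
    k.IsChain i (k.d • c) := by
  intro s hs
  rw [Matrix.Module.smul_apply]
  refine Finset.sum_eq_zero fun t _ => ?_
  by_cases h : k.d s t = 0
  · rw [h, zero_smul]
  · rw [hc t (by have := k.deg_d s t h; omega), smul_zero]

theorem isChain_e_smul {i : ℕ} {c : k.T → M} (hc : k.IsChain i c) (j : Fin n) :
    k.IsChain (i + 1) (k.e j • c) := by
  intro s hs
  rw [Matrix.Module.smul_apply]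
  refine Finset.sum_eq_zero fun t _ => ?_
  by_cases h : k.e j s t = 0
  · rw [h, zero_smul]
  · rw [hc t (by have := k.deg_e j s t h; omega), smul_zero]

theorem d_smul_e_smul (j : Fin n) (c : k.T → M) :
    k.d • k.e j • c = f j • c - k.e j • k.d • c := by
  have h : (k.d * k.e j) • c + (k.e j * k.d) • c = f j • c := by
    rw [← add_smul, k.d_mul_e]
    ext t
    simp [Matrix.one_apply]
  rw [← h, mul_smul, mul_smul, add_sub_cancel_right]

theorem smul_d_smul (r : R) (c : k.T → M) : k.d • r • c = r • k.d • c := by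
  ext t
  simp only [Matrix.Module.smul_apply, Pi.smul_apply, Finset.smul_sum]
  exact Finset.sum_congr rfl fun _ _ => smul_comm _ _ _

/-- Multiplication by an element of the ideal generated by the `f j` is null-homotopic. -/
theorem exists_d_smul_eq_of_mem_span {g : R} (hg : g ∈ Ideal.span (Set.range f)) {i : ℕ}
    {c : k.T → M} (hc : k.IsChain i c) (hdc : k.d • c = 0) :
    ∃ b : k.T → M, k.IsChain (i + 1) b ∧ k.d • b = g • c := by
  induction hg using Submodule.span_induction with
  | mem x hx =>
    obtain ⟨j, rfl⟩ := hx
    exact ⟨k.e j • c, k.isChain_e_smul hc j, by rw [d_smul_e_smul, hdc, smul_zero, sub_zero]⟩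
  | zero => exact ⟨0, fun _ _ => rfl, by simp⟩
  | add x y _ _ hx hy =>
    obtain ⟨b, hb, hb'⟩ := hx
    obtain ⟨b₂, hb₂, hb₂'⟩ := hy
    exact ⟨b + b₂, fun t ht => by simp [hb t ht, hb₂ t ht], by rw [smul_add, hb', hb₂', add_smul]⟩
  | smul r x _ hx =>
    obtain ⟨b, hb, hb'⟩ := hx
    exact ⟨r • b, fun t ht => by simp [hb t ht], by rw [smul_d_smul, hb', smul_eq_mul, mul_smul]⟩

/-- Depth sensitivity of the Koszul complex: if the ideal generated by `f₀, …, f_{n-1}` contains an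
`M`-regular sequence of length `r`, then the homology with coefficients in `M` vanishes in degrees
`> n - r`. -/
theorem exists_d_smul_eq_of_isWeaklyRegular (gs : List R)
    (hgs : ∀ g ∈ gs, g ∈ Ideal.span (Set.range f)) :
    ∀ {M : Type*} [AddCommGroup M] [Module R M],
      RingTheory.Sequence.IsWeaklyRegular M gs → ∀ (i : ℕ) (c : k.T → M), k.IsChain i c →
      n < i + gs.length → k.d • c = 0 → ∃ b : k.T → M, k.IsChain (i + 1) b ∧ k.d • b = c := by
  induction gs with
  | nil =>
    intro M _ _ _ i c hc hi _
    refine ⟨0, fun _ _ => rfl, ?_⟩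
    rw [smul_zero]
    ext t
    -- No basis element has degree above `n`, so `c` itself is zero.
    exact (hc t (by have := k.deg_le t; simp at hi; omega)).symm
  | cons g gs ih =>
    intro M _ _ hreg i c hc hi hdc
    rw [RingTheory.Sequence.isWeaklyRegular_cons_iff] at hreg
    -- Write `g • c = d b`. Then `b` is a cycle modulo `g`, hence by induction a boundary modulo
    -- `g`. Lifting gives `b - d β = g • γ`, so `g • d γ = g • c`, and `g` cancels.
    obtain ⟨b, hb, hdb⟩ := k.exists_d_smul_eq_of_mem_span (hgs g (by simp)) hc hdc
    let q : M →ₗ[R] QuotSMulTop g M := Submodule.mkQ _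
    have hq : ∀ c : k.T → M, k.d • (fun t => q (c t)) = fun t => q ((k.d • c) t) := by
      intro c
      ext t
      simp [Matrix.Module.smul_apply, map_sum]
    have hq0 : ∀ m : M, q m = 0 ↔ ∃ m' : M, g • m' = m := by
      intro m
      simp only [q, Submodule.mkQ_apply, Submodule.Quotient.mk_eq_zero,
        Submodule.mem_smul_pointwise_iff_exists, Submodule.mem_top, true_and]
    obtain ⟨b', hb', hdb'⟩ := ih (fun x hx => hgs x (by simp [hx])) hreg.2 (i + 1)
      (fun t => q (b t)) (fun t ht => by simp [hb t ht]) (by simp at hi; omega) (by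
        rw [hq, hdb]
        ext t
        exact (hq0 _).2 ⟨c t, rfl⟩)
    -- The lifts are chosen to be `0` off the relevant degree, so that they are again chains.
    have hlift : ∀ t, ∃ m : M, q m = b' t ∧ (k.deg t ≠ i + 1 + 1 → m = 0) := by
      intro t
      by_cases ht : k.deg t = i + 1 + 1
      · obtain ⟨m, hm⟩ := Submodule.mkQ_surjective _ (b' t)
        exact ⟨m, hm, fun h => absurd ht h⟩
      · exact ⟨0, by rw [hb' t ht, map_zero], fun _ => rfl⟩
    choose β hβ hβ' using hlift
    have hdiff : ∀ t, ∃ m : M, g • m = (b - k.d • β) t ∧ (k.deg t ≠ i + 1 → m = 0) := by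
      intro t
      by_cases ht : k.deg t = i + 1
      · obtain ⟨m, hm⟩ := (hq0 ((b - k.d • β) t)).1 (by
          have h1 := congrFun (hq β) t
          have h2 : (fun t => q (β t)) = b' := funext hβ
          rw [h2, hdb'] at h1
          rw [Pi.sub_apply, map_sub, ← h1, sub_self])
        exact ⟨m, hm, fun h => absurd ht h⟩
      · refine ⟨0, ?_, fun _ => rfl⟩
        rw [smul_zero, Pi.sub_apply, hb t ht, k.isChain_d_smul hβ' t ht, sub_zero]
    choose γ hγ hγ' using hdiff
    have hγ'' : g • γ = b - k.d • β := funext hγ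
    refine ⟨γ, hγ', ?_⟩
    have h3 : g • k.d • γ = g • c := by
      rw [← smul_d_smul, hγ'', smul_sub, d_smul_d_smul, sub_zero, hdb]
    ext t
    exact hreg.1 (congrFun h3 t)

end KoszulMatrices

/-! ### The regular sequence of powers of variables. -/

/-- Powers of the variables form a regular sequence. -/
theorem isWeaklyRegular_X_pow (K : Type*) [Field K] {n : ℕ} (N : Fin n → ℕ) :
    RingTheory.Sequence.IsWeaklyRegular (MvPolynomial (Fin n) K)
      (List.ofFn fun j => (X j : MvPolynomial (Fin n) K) ^ N j) := by
  rw [RingTheory.Sequence.isWeaklyRegular_iff]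
  intro i hi
  have hin : i < n := by simpa using hi
  have hI : (Ideal.ofList (List.take i (List.ofFn fun j => (X j : MvPolynomial (Fin n) K) ^ N j)) :
      Ideal (MvPolynomial (Fin n) K)) = Ideal.span ((fun s => monomial s (1 : K)) ''
        {s | ∃ j : Fin n, (j : ℕ) < i ∧ s = Finsupp.single j (N j)}) := by
    unfold Ideal.ofList
    congr 1
    ext p
    simp only [Set.mem_ofPred_eq, Set.mem_image, List.mem_take_iff_getElem, List.length_ofFn,
      List.getElem_ofFn]
    constructor
    · rintro ⟨j, hj, rfl⟩
      exact ⟨_, ⟨⟨j, by omega⟩, by simp; omega, rfl⟩, by rw [X_pow_eq_monomial]⟩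
    · rintro ⟨_, ⟨j, hj, rfl⟩, rfl⟩
      exact ⟨j, by have := j.2; omega, by rw [X_pow_eq_monomial]⟩
  -- The ideal is monomial, so membership is tested on supports: a power of a variable with index
  -- below `i` dividing `X_i ^ N_i * m` already divides `m`.
  rw [isSMulRegular_quotient_iff_mem_of_smul_mem, hI, smul_eq_mul, Ideal.mul_top]
  intro p hp
  rw [mem_ideal_span_monomial_image] at hp ⊢
  intro m hm
  rw [List.getElem_ofFn, X_pow_eq_monomial, smul_eq_mul] at hp
  obtain ⟨_, ⟨j, hj, rfl⟩, hle⟩ := hp (Finsupp.single ⟨i, hin⟩ (N ⟨i, hin⟩) + m) (by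
    rw [mem_support_iff, coeff_monomial_mul, one_mul]
    exact mem_support_iff.1 hm)
  refine ⟨_, ⟨j, hj, rfl⟩, ?_⟩
  rw [Finsupp.single_le_iff] at hle ⊢
  have hne : (⟨i, hin⟩ : Fin n) ≠ j := by
    rintro rfl
    exact lt_irrefl _ hj
  simpa [Finsupp.single_apply, hne] using hle

/-! ### Graded free modules and minimal covers. -/

section GradedFree

variable {K : Type*} [Field K] {σ : Type*}

theorem mem_gradedFreePart {r : ℕ} {deg : Fin r → ℤ} {e : ℤ} {v : Fin r → MvPolynomial σ K} :
    v ∈ gradedFreePart K σ deg e ↔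
      ∀ k, (v k).IsWeightedHomogeneous (fun _ : σ => (1 : ℤ)) (e - deg k) := by
  simp [gradedFreePart, Submodule.mem_pi, mem_weightedHomogeneousSubmodule]

/-- The projection of a graded free module onto its component of degree `e`. -/
def gradedFreeProj {r : ℕ} (deg : Fin r → ℤ) (e : ℤ) :
    (Fin r → MvPolynomial σ K) →+ (Fin r → MvPolynomial σ K) where
  toFun v k := weightedHomogeneousComponent (fun _ : σ => (1 : ℤ)) (e - deg k) (v k)
  map_zero' := by ext1 k; simp
  map_add' v w := by ext1 k; simp

theorem gradedFreeProj_apply {r : ℕ} (deg : Fin r → ℤ) (e : ℤ) (v : Fin r → MvPolynomial σ K)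
    (k : Fin r) : gradedFreeProj deg e v k =
      weightedHomogeneousComponent (fun _ : σ => (1 : ℤ)) (e - deg k) (v k) := rfl

theorem gradedFreeProj_mem {r : ℕ} (deg : Fin r → ℤ) (e : ℤ) (v : Fin r → MvPolynomial σ K) :
    gradedFreeProj deg e v ∈ gradedFreePart K σ deg e :=
  mem_gradedFreePart.2 fun _ => weightedHomogeneousComponent_isWeightedHomogeneous _ _

theorem gradedFreeProj_of_mem {r : ℕ} {deg : Fin r → ℤ} {e : ℤ} {v : Fin r → MvPolynomial σ K}
    (hv : v ∈ gradedFreePart K σ deg e) : gradedFreeProj deg e v = v :=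
  funext fun k => weightedHomogeneousComponent_eq_self (mem_gradedFreePart.1 hv k)

theorem gradedFreeProj_of_mem_of_ne {r : ℕ} {deg : Fin r → ℤ} {i e : ℤ}
    {v : Fin r → MvPolynomial σ K} (hv : v ∈ gradedFreePart K σ deg i) (h : e ≠ i) :
    gradedFreeProj deg e v = 0 :=
  funext fun k => (mem_gradedFreePart.1 hv k).weightedHomogeneousComponent_ne _ (by omega)

/-- Every element of a graded free module is a finite sum of homogeneous elements. -/
theorem gradedFree_induction {r : ℕ} (deg : Fin r → ℤ)
    {motive : (Fin r → MvPolynomial σ K) → Prop} (zero : motive 0)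
    (add : ∀ v w, motive v → motive w → motive (v + w))
    (mem : ∀ e, ∀ v ∈ gradedFreePart K σ deg e, motive v) (v : Fin r → MvPolynomial σ K) :
    motive v := by
  have hsum : ∀ {ι : Type _} (s : Finset ι) (g : ι → Fin r → MvPolynomial σ K),
      (∀ i, motive (g i)) → motive (∑ i ∈ s, g i) := by
    classical
    intro ι s g hg
    induction s using Finset.induction_on with
    | empty => simpa using zero
    | insert a s ha ih => rw [Finset.sum_insert ha]; exact add _ _ (hg a) ih
  have hsingle : ∀ (k : Fin r) (p : MvPolynomial σ K), motive (Pi.single k p) := by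
    intro k p
    induction p using MvPolynomial.induction_on' with
    | monomial m a =>
      refine mem (deg k + Finsupp.weight (fun _ : σ => (1 : ℤ)) m) _ (mem_gradedFreePart.2 ?_)
      intro j
      by_cases hj : j = k
      · subst hj
        rw [Pi.single_eq_same]
        exact isWeightedHomogeneous_monomial _ _ _ (by ring)
      · rw [Pi.single_eq_of_ne hj]
        exact isWeightedHomogeneous_zero _ _ _
    | add p q hp hq => rw [Pi.single_add]; exact add _ _ hp hq
  rw [← Finset.univ_sum_single v]
  exact hsum _ _ fun k => hsingle k _

/-- Homogeneous maps commute with the projections to the homogeneous components. -/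
theorem map_gradedFreeProj {r : ℕ} {deg : Fin r → ℤ} {N : Type*} [AddCommGroup N]
    (φ : (Fin r → MvPolynomial σ K) →+ N) (p : ℤ → N →+ N)
    (hp : ∀ i, ∀ v ∈ gradedFreePart K σ deg i, p i (φ v) = φ v ∧ ∀ e, e ≠ i → p e (φ v) = 0)
    (e : ℤ) (v : Fin r → MvPolynomial σ K) : φ (gradedFreeProj deg e v) = p e (φ v) := by
  induction v using gradedFree_induction deg with
  | zero => simp
  | add v w hv hw => simp [hv, hw]
  | mem i v hv =>
    by_cases h : e = i
    · subst h
      rw [gradedFreeProj_of_mem hv, (hp e v hv).1]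
    · rw [gradedFreeProj_of_mem_of_ne hv h, (hp i v hv).2 e h, map_zero]

theorem map_gradedFreeProj_of_homogeneous {r r' : ℕ} {deg : Fin r → ℤ} {deg' : Fin r' → ℤ}
    (d : (Fin r' → MvPolynomial σ K) →ₗ[MvPolynomial σ K] (Fin r → MvPolynomial σ K))
    (hd : ∀ e, ∀ v ∈ gradedFreePart K σ deg' e, d v ∈ gradedFreePart K σ deg e)
    (e : ℤ) (v : Fin r' → MvPolynomial σ K) :
    d (gradedFreeProj deg' e v) = gradedFreeProj deg e (d v) :=
  map_gradedFreeProj d.toAddMonoidHom (gradedFreeProj deg)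
    (fun i v hv => ⟨gradedFreeProj_of_mem (hd i v hv),
      fun _ h => gradedFreeProj_of_mem_of_ne (hd i v hv) h⟩) e v

/-- Allowing every larger index set makes the statement additive: the sets for two summands are
replaced by their union. -/
theorem exists_sum_gradedFreeProj {r : ℕ} (deg : Fin r → ℤ) (v : Fin r → MvPolynomial σ K) :
    ∃ s : Finset ℤ, ∀ s', s ⊆ s' → ∑ e ∈ s', gradedFreeProj deg e v = v := by
  classical
  induction v using gradedFree_induction deg with
  | zero => exact ⟨∅, by simp⟩
  | add v w hv hw =>
    obtain ⟨s, hs⟩ := hv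
    obtain ⟨t, ht⟩ := hw
    refine ⟨s ∪ t, fun s' h => ?_⟩
    simp only [map_add, Finset.sum_add_distrib]
    rw [hs s' (Finset.union_subset_left h), ht s' (Finset.union_subset_right h)]
  | mem i v hv =>
    refine ⟨{i}, fun s' h => ?_⟩
    rw [Finset.sum_eq_single i (fun e _ he => gradedFreeProj_of_mem_of_ne hv he)
      (fun hi => absurd (h (Finset.mem_singleton_self i)) hi), gradedFreeProj_of_mem hv]

theorem mem_span_range_X_iff {p : MvPolynomial σ K} :
    p ∈ Ideal.span (Set.range (X : σ → MvPolynomial σ K)) ↔ coeff 0 p = 0 := by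
  rw [← Set.image_univ, mem_ideal_span_X_image]
  constructor
  · intro h
    by_contra h0
    obtain ⟨i, _, hi⟩ := h 0 (mem_support_iff.2 h0)
    exact hi rfl
  · intro h m hm
    by_contra! hcon
    have : m = 0 := Finsupp.ext fun i => hcon i trivial
    subst this
    exact mem_support_iff.1 hm h

theorem weight_one_eq_zero_iff (m : σ →₀ ℕ) :
    Finsupp.weight (fun _ : σ => (1 : ℤ)) m = 0 ↔ m = 0 := by
  constructor
  · intro h
    rw [Finsupp.weight_apply, Finsupp.sum] at h
    have h' : ∑ i ∈ m.support, (m i : ℤ) = 0 := by simpa using h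
    rw [Finset.sum_eq_zero_iff_of_nonneg fun i _ => Int.natCast_nonneg _] at h'
    ext i
    by_contra hi
    exact hi (by exact_mod_cast h' i (Finsupp.mem_support_iff.2 hi))
  · rintro rfl
    simp

theorem weightedHomogeneousComponent_one_zero (p : MvPolynomial σ K) :
    weightedHomogeneousComponent (fun _ : σ => (1 : ℤ)) 0 p = C (coeff 0 p) := by
  classical
  ext m
  rw [coeff_weightedHomogeneousComponent, coeff_C]
  simp only [weight_one_eq_zero_iff, eq_comm (a := (0 : σ →₀ ℕ))]
  split_ifs with h
  · rw [h]
  · rfl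

/-- A coordinate of a homogeneous element which is not in the ideal of the variables has
degree `0`. -/
theorem eq_of_mem_gradedFreePart_of_notMem {r : ℕ} {deg : Fin r → ℤ} {e : ℤ}
    {v : Fin r → MvPolynomial σ K} (hv : v ∈ gradedFreePart K σ deg e) {k : Fin r}
    (hk : v k ∉ Ideal.span (Set.range (X : σ → MvPolynomial σ K))) : deg k = e := by
  rw [mem_span_range_X_iff] at hk
  have := mem_gradedFreePart.1 hv k hk
  rw [map_zero] at this
  omega

/-- Maps from a graded free module given on the basis by homogeneous elements are homogeneous. -/
theorem linearCombination_mem_gradedFreePart {r m : ℕ} {deg : Fin r → ℤ} {deg' : Fin m → ℤ}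
    {g : Fin m → Fin r → MvPolynomial σ K} (hg : ∀ k, g k ∈ gradedFreePart K σ deg (deg' k))
    {e : ℤ} {v : Fin m → MvPolynomial σ K} (hv : v ∈ gradedFreePart K σ deg' e) :
    Fintype.linearCombination (MvPolynomial σ K) g v ∈ gradedFreePart K σ deg e := by
  rw [Fintype.linearCombination_apply]
  refine Submodule.sum_mem _ fun k _ => mem_gradedFreePart.2 fun j => ?_
  have := (mem_gradedFreePart.1 hv k).mul (mem_gradedFreePart.1 (hg k) j)
  rwa [show e - deg' k + (deg' k - deg j) = e - deg j by ring] at this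

/-- A submodule of a graded free module is graded if it contains the homogeneous components of its
elements. -/
def IsGradedSubmodule {r : ℕ} (deg : Fin r → ℤ)
    (N : Submodule (MvPolynomial σ K) (Fin r → MvPolynomial σ K)) : Prop :=
  ∀ v ∈ N, ∀ e, gradedFreeProj deg e v ∈ N

theorem IsGradedSubmodule.span_eq {r : ℕ} {deg : Fin r → ℤ}
    {N : Submodule (MvPolynomial σ K) (Fin r → MvPolynomial σ K)}
    (hN : IsGradedSubmodule deg N) :
    Submodule.span (MvPolynomial σ K) {v | v ∈ N ∧ ∃ e, v ∈ gradedFreePart K σ deg e} = N := by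
  apply le_antisymm
  · rw [Submodule.span_le]
    exact fun v hv => hv.1
  · intro v hv
    obtain ⟨s, hs⟩ := exists_sum_gradedFreeProj deg v
    rw [← hs s subset_rfl]
    exact Submodule.sum_mem _ fun e _ =>
      Submodule.subset_span ⟨hN v hv e, e, gradedFreeProj_mem deg e v⟩

theorem isGradedSubmodule_ker {r r' : ℕ} {deg : Fin r → ℤ} {deg' : Fin r' → ℤ}
    (d : (Fin r' → MvPolynomial σ K) →ₗ[MvPolynomial σ K] (Fin r → MvPolynomial σ K))
    (hd : ∀ e, ∀ v ∈ gradedFreePart K σ deg' e, d v ∈ gradedFreePart K σ deg e) :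
    IsGradedSubmodule deg' (LinearMap.ker d) := by
  intro v hv e
  rw [LinearMap.mem_ker] at hv ⊢
  rw [map_gradedFreeProj_of_homogeneous d hd, hv, map_zero]

/-- `m` homogeneous elements generate `N`. -/
def HasHomogeneousGenerators {r : ℕ} (deg : Fin r → ℤ)
    (N : Submodule (MvPolynomial σ K) (Fin r → MvPolynomial σ K)) (m : ℕ) : Prop :=
  ∃ (g : Fin m → Fin r → MvPolynomial σ K) (deg' : Fin m → ℤ),
    (∀ k, g k ∈ gradedFreePart K σ deg (deg' k)) ∧
      Submodule.span (MvPolynomial σ K) (Set.range g) = N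

/-- The homogeneous elements generate, and by noetherianity finitely many of them suffice. -/
theorem IsGradedSubmodule.exists_hasHomogeneousGenerators [Finite σ] {r : ℕ} {deg : Fin r → ℤ}
    {N : Submodule (MvPolynomial σ K) (Fin r → MvPolynomial σ K)}
    (hN : IsGradedSubmodule deg N) : ∃ m, HasHomogeneousGenerators deg N m := by
  have hfg : (Submodule.span (MvPolynomial σ K)
      {v | v ∈ N ∧ ∃ e, v ∈ gradedFreePart K σ deg e}).FG := by
    rw [hN.span_eq]
    exact IsNoetherian.noetherian N
  obtain ⟨s, hs, hspan⟩ := Submodule.fg_span_iff_fg_span_finset_subset _ |>.1 hfg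
  rw [hN.span_eq] at hspan
  choose d hd using fun x : s => (hs x.2).2
  refine ⟨s.card, fun k => s.equivFin.symm k, fun k => d (s.equivFin.symm k),
    fun k => hd _, ?_⟩
  rw [hspan]
  congr 1
  ext v
  constructor
  · rintro ⟨k, rfl⟩
    exact (s.equivFin.symm k).2
  · intro hv
    exact ⟨s.equivFin ⟨v, hv⟩, by simp⟩

/-- A graded submodule of a graded free module of finite rank has a minimal cover by a graded
free module of finite rank. -/
theorem IsGradedSubmodule.exists_minimal_cover [Finite σ] {r : ℕ} {deg : Fin r → ℤ}
    {N : Submodule (MvPolynomial σ K) (Fin r → MvPolynomial σ K)}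
    (hN : IsGradedSubmodule deg N) :
    ∃ (m : ℕ) (deg' : Fin m → ℤ)
      (d : (Fin m → MvPolynomial σ K) →ₗ[MvPolynomial σ K] (Fin r → MvPolynomial σ K)),
      LinearMap.range d = N ∧
      (∀ e, ∀ v ∈ gradedFreePart K σ deg' e, d v ∈ gradedFreePart K σ deg e) ∧
      ∀ v, d v = 0 → ∀ k, v k ∈ Ideal.span (Set.range (X : σ → MvPolynomial σ K)) := by
  classical
  have hex := hN.exists_hasHomogeneousGenerators
  -- The number of homogeneous generators is taken minimal; a relation with a coefficient of nonzero
  -- constant term will make one of them redundant.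
  obtain ⟨g, deg', hg, hspan⟩ := Nat.find_spec hex
  have hmin : ∀ m, HasHomogeneousGenerators deg N m → Nat.find hex ≤ m :=
    fun m => Nat.find_min' hex
  generalize Nat.find hex = m at g deg' hg hspan hmin
  have hhom : ∀ e, ∀ v ∈ gradedFreePart K σ deg' e,
      Fintype.linearCombination (MvPolynomial σ K) g v ∈ gradedFreePart K σ deg e :=
    fun e v hv => linearCombination_mem_gradedFreePart hg hv
  refine ⟨m, deg', Fintype.linearCombination (MvPolynomial σ K) g,
    by rw [Fintype.range_linearCombination, hspan], hhom, ?_⟩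
  intro v hv k
  by_contra hk
  rw [mem_span_range_X_iff] at hk
  -- The component of degree `deg' k` of the relation is again a relation, and its `k`-th
  -- coefficient is a nonzero constant, hence a unit.
  have hw := map_gradedFreeProj_of_homogeneous _ hhom (deg' k) v
  rw [hv, map_zero] at hw
  set w := gradedFreeProj deg' (deg' k) v with hwdef
  have hwk : w k = C (coeff 0 (v k)) := by
    rw [hwdef, gradedFreeProj_apply, sub_self, weightedHomogeneousComponent_one_zero]
  obtain ⟨m, rfl⟩ : ∃ m', m = m' + 1 := ⟨m - 1, by have := k.pos; omega⟩
  have hgk : g k ∈ Submodule.span (MvPolynomial σ K) (Set.range (g ∘ k.succAbove)) := by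
    rw [Fintype.linearCombination_apply, Fin.sum_univ_succAbove _ k, hwk] at hw
    have h1 : g k = -(C (coeff 0 (v k))⁻¹ : MvPolynomial σ K) •
        ∑ i : Fin m, w (k.succAbove i) • g (k.succAbove i) := by
      have h2 := eq_neg_of_add_eq_zero_right hw
      rw [h2, smul_neg, neg_smul, neg_neg, smul_smul, ← C_mul, inv_mul_cancel₀ hk, C_1, one_smul]
    rw [h1]
    exact Submodule.smul_mem _ _ (Submodule.sum_mem _ fun i _ =>
      Submodule.smul_mem _ _ (Submodule.subset_span ⟨i, rfl⟩))
  have := hmin m ⟨g ∘ k.succAbove, deg' ∘ k.succAbove, fun i => hg _, by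
    rw [← hspan]
    refine le_antisymm (Submodule.span_mono (Set.range_comp_subset_range _ _)) ?_
    rw [Submodule.span_le]
    rintro _ ⟨i, rfl⟩
    induction i using Fin.succAboveCases k with
    | x => exact hgk
    | p i => exact Submodule.subset_span ⟨i, rfl⟩⟩
  omega

end GradedFree

/-! ### Existence of the minimal graded free resolution. -/

section Existence

variable {K : Type*} [Field K] {σ : Type*}

/-- A graded submodule of a graded free module of finite rank: the module of which the next step of
a resolution is a cover. -/
structure GradedSyzygy (K : Type*) [Field K] (σ : Type*) where
  rank : ℕ
  deg : Fin rank → ℤ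
  N : Submodule (MvPolynomial σ K) (Fin rank → MvPolynomial σ K)
  graded : IsGradedSubmodule deg N
  le : ∀ v ∈ N, ∀ k, v k ∈ Ideal.span (Set.range (X : σ → MvPolynomial σ K))

namespace GradedSyzygy

variable [Finite σ] (Z : GradedSyzygy K σ)

/-- The differential of a minimal cover. -/
def cover : (Fin Z.graded.exists_minimal_cover.choose → MvPolynomial σ K) →ₗ[MvPolynomial σ K]
    (Fin Z.rank → MvPolynomial σ K) :=
  Z.graded.exists_minimal_cover.choose_spec.choose_spec.choose

/-- The kernel of a minimal cover. -/
def next : GradedSyzygy K σ where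
  rank := Z.graded.exists_minimal_cover.choose
  deg := Z.graded.exists_minimal_cover.choose_spec.choose
  N := LinearMap.ker Z.cover
  graded := isGradedSubmodule_ker _
    Z.graded.exists_minimal_cover.choose_spec.choose_spec.choose_spec.2.1
  le v hv := Z.graded.exists_minimal_cover.choose_spec.choose_spec.choose_spec.2.2 v hv

theorem range_cover : LinearMap.range Z.cover = Z.N :=
  Z.graded.exists_minimal_cover.choose_spec.choose_spec.choose_spec.1

theorem mem_N_iff (v : Fin Z.rank → MvPolynomial σ K) : v ∈ Z.N ↔ v ∈ Set.range Z.cover :=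
  (SetLike.ext_iff.1 Z.range_cover v).symm

theorem cover_homogeneous : ∀ e, ∀ v ∈ gradedFreePart K σ Z.next.deg e,
    Z.cover v ∈ gradedFreePart K σ Z.deg e :=
  Z.graded.exists_minimal_cover.choose_spec.choose_spec.choose_spec.2.1

/-- The iterated syzygies. -/
def iterate : ℕ → GradedSyzygy K σ
  | 0 => Z
  | i + 1 => (iterate i).next

end GradedSyzygy

/-- Hilbert: the quotient by a homogeneous ideal contained in the ideal of the variables has a
minimal graded free resolution. -/
theorem nonempty_minimalGradedFreeResolution [Finite σ] (I : Ideal (MvPolynomial σ K))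
    (hI : ∀ p ∈ I, ∀ e : ℤ, weightedHomogeneousComponent (fun _ : σ => (1 : ℤ)) e p ∈ I)
    (hIX : I ≤ Ideal.span (Set.range X)) :
    Nonempty (MinimalGradedFreeResolution (σ := σ) (quotientGrading I)) := by
  let aug : (Fin 1 → MvPolynomial σ K) →ₗ[MvPolynomial σ K] MvPolynomial σ K ⧸ I :=
    (Submodule.mkQ I) ∘ₗ LinearMap.proj 0
  have haug : ∀ v, aug v = 0 ↔ v 0 ∈ I := fun v => Submodule.Quotient.mk_eq_zero I
  let Z : GradedSyzygy K σ :=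
    { rank := 1
      deg := 0
      N := LinearMap.ker aug
      graded := fun v hv e => (haug _).2 (hI _ ((haug v).1 hv) _)
      le := fun v hv k => by
        rw [Subsingleton.elim k 0]
        exact hIX ((haug v).1 hv) }
  refine ⟨{ rank := fun i => (Z.iterate i).rank
            deg := fun i => (Z.iterate i).deg
            d := fun i => (Z.iterate i).cover
            aug := aug
            d_homogeneous := fun i => (Z.iterate i).cover_homogeneous
            aug_homogeneous := ?_
            aug_surjective := ?_
            exact_aug := ?_
            exact_d := ?_
            minimal := ?_ }⟩
  · intro e (v : Fin 1 → MvPolynomial σ K) hv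
    refine ⟨v 0, ?_, rfl⟩
    have := (mem_gradedFreePart (deg := (0 : Fin 1 → ℤ))).1 hv 0
    simpa [Z, GradedSyzygy.iterate] using this
  · intro q
    obtain ⟨p, rfl⟩ := Submodule.mkQ_surjective _ q
    exact ⟨fun _ => p, rfl⟩
  · exact Z.mem_N_iff
  · intro i
    exact (Z.iterate (i + 1)).mem_N_iff
  · intro i v k
    refine (Z.iterate i).le _ ?_ k
    rw [← (Z.iterate i).range_cover]
    exact ⟨v, rfl⟩

end Existence

/-! ### Homogeneous components in the quotient. -/

section QuotientGrading

variable {K : Type*} [Field K] {σ : Type*} {I : Ideal (MvPolynomial σ K)}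

/-- The homogeneous components of the elements of the quotient by a homogeneous ideal. -/
def quotientProj
    (hI : ∀ p ∈ I, ∀ e : ℤ, weightedHomogeneousComponent (fun _ : σ => (1 : ℤ)) e p ∈ I) (e : ℤ) :
    (MvPolynomial σ K ⧸ I) →+ (MvPolynomial σ K ⧸ I) :=
  QuotientAddGroup.map I.toAddSubgroup I.toAddSubgroup
    (weightedHomogeneousComponent (fun _ : σ => (1 : ℤ)) e).toAddMonoidHom fun p hp => hI p hp e

theorem quotientProj_mk
    (hI : ∀ p ∈ I, ∀ e : ℤ, weightedHomogeneousComponent (fun _ : σ => (1 : ℤ)) e p ∈ I) (e : ℤ)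
    (p : MvPolynomial σ K) : quotientProj hI e (Ideal.Quotient.mk I p) =
      Ideal.Quotient.mk I (weightedHomogeneousComponent (fun _ : σ => (1 : ℤ)) e p) := rfl

/-- The class of `1` lifts to an element of degree `0` of a graded free cover of the quotient by a
homogeneous ideal. -/
theorem MinimalGradedFreeResolution.exists_aug_eq_one
    (hI : ∀ p ∈ I, ∀ e : ℤ, weightedHomogeneousComponent (fun _ : σ => (1 : ℤ)) e p ∈ I)
    (F : MinimalGradedFreeResolution (σ := σ) (quotientGrading I)) :
    ∃ u ∈ gradedFreePart K σ (F.deg 0) 0, F.aug u = 1 := by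
  obtain ⟨v, hv⟩ := F.aug_surjective 1
  refine ⟨gradedFreeProj (F.deg 0) 0 v, gradedFreeProj_mem _ _ _, ?_⟩
  have := map_gradedFreeProj F.aug.toAddMonoidHom (quotientProj hI) (by
    intro i v hv
    obtain ⟨p, hp, hpv⟩ := F.aug_homogeneous i v hv
    have hpv' : F.aug.toAddMonoidHom v = Ideal.Quotient.mk I p := hpv.symm
    have hp' : p.IsWeightedHomogeneous (fun _ : σ => (1 : ℤ)) i := hp
    rw [hpv', quotientProj_mk, weightedHomogeneousComponent_eq_self hp']
    exact ⟨rfl, fun e he => by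
      rw [quotientProj_mk, hp'.weightedHomogeneousComponent_ne _ he, map_zero]⟩) 0 v
  refine this.trans ?_
  change quotientProj hI 0 (F.aug v) = 1
  rw [hv, ← map_one (Ideal.Quotient.mk I), quotientProj_mk,
    weightedHomogeneousComponent_eq_self (isWeightedHomogeneous_one _ _)]

end QuotientGrading

/-! ### The Koszul differential on the tensor algebra. -/

section TensorComplex

variable {S : Type*} [CommRing S] {n : ℕ} (f : Fin n → S)

/-- The differential of the tensor algebra on generators `e₀, …, e_{n-1}`: the contraction
`d (e_j ⊗ x) = f_j x - e_j ⊗ d x`. Words of length `i` are functions `Fin i → Fin n`. -/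
def tensorD : ∀ i : ℕ, ((Fin (i + 1) → Fin n) →₀ S) →ₗ[S] ((Fin i → Fin n) →₀ S)
  | 0 => Finsupp.linearCombination S fun a => Finsupp.single (Fin.tail a) (f (a 0))
  | i + 1 => Finsupp.linearCombination S fun a => Finsupp.single (Fin.tail a) (f (a 0)) -
      Finsupp.lmapDomain S S (Fin.cons (a 0)) (tensorD i (Finsupp.single (Fin.tail a) 1))

theorem tensorD_zero_single (a : Fin 1 → Fin n) :
    tensorD f 0 (Finsupp.single a 1) = f (a 0) • Finsupp.single (Fin.tail a) 1 := by
  simp [tensorD]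

theorem tensorD_succ_single {i : ℕ} (a : Fin (i + 2) → Fin n) :
    tensorD f (i + 1) (Finsupp.single a 1) = f (a 0) • Finsupp.single (Fin.tail a) 1 -
      Finsupp.lmapDomain S S (Fin.cons (α := fun _ => Fin n) (a 0))
        (tensorD f i (Finsupp.single (Fin.tail a) 1)) := by
  simp [tensorD]

theorem tensorD_cons {i : ℕ} (j : Fin n) (x : (Fin (i + 1) → Fin n) →₀ S) :
    tensorD f (i + 1) (Finsupp.lmapDomain S S (Fin.cons (α := fun _ => Fin n) j) x) =
      f j • x - Finsupp.lmapDomain S S (Fin.cons (α := fun _ => Fin n) j) (tensorD f i x) := by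
  suffices h : tensorD f (i + 1) ∘ₗ Finsupp.lmapDomain S S (Fin.cons (α := fun _ => Fin n) j) =
      f j • LinearMap.id -
        Finsupp.lmapDomain S S (Fin.cons (α := fun _ => Fin n) j) ∘ₗ tensorD f i from
    LinearMap.congr_fun h x
  ext1 a
  ext1
  simp only [LinearMap.comp_apply, Finsupp.lsingle_apply, Finsupp.lmapDomain_apply,
    Finsupp.mapDomain_single, LinearMap.sub_apply, LinearMap.smul_apply, LinearMap.id_apply]
  rw [tensorD_succ_single]
  simp [Finsupp.lmapDomain_apply]

/-- The Leibniz rule `tensorD_cons` gives `d d (e_j x) = f_j d x - (f_j d x - e_j d d x) = e_j d d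
x`, so the claim passes to longer words. -/
theorem tensorD_tensorD {i : ℕ} (x : (Fin (i + 2) → Fin n) →₀ S) :
    tensorD f i (tensorD f (i + 1) x) = 0 := by
  suffices h : tensorD f i ∘ₗ tensorD f (i + 1) = 0 from LinearMap.congr_fun h x
  clear x
  induction i with
  | zero =>
    ext1 a
    ext1
    simp only [LinearMap.comp_apply, Finsupp.lsingle_apply, LinearMap.zero_apply]
    rw [tensorD_succ_single, tensorD_zero_single, map_sub, map_smul, tensorD_zero_single, map_smul,
      Finsupp.lmapDomain_apply, Finsupp.mapDomain_single, map_smul, tensorD_zero_single,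
      Fin.cons_zero, Fin.tail_cons, smul_comm, sub_self]
  | succ i ih =>
    ext1 a
    ext1
    simp only [LinearMap.comp_apply, Finsupp.lsingle_apply, LinearMap.zero_apply]
    rw [tensorD_succ_single, map_sub, map_smul, tensorD_cons,
      show tensorD f i (tensorD f (i + 1) _) = 0 from LinearMap.congr_fun ih _]
    simp

/-- Needed to kill the homotopy term `h ∘ d` modulo the variables. -/
theorem tensorD_mem {i : ℕ} (x : (Fin (i + 1) → Fin n) →₀ S) :
    tensorD f i x ∈
      Ideal.span (Set.range f) • (⊤ : Submodule S ((Fin i → Fin n) →₀ S)) := by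
  suffices h : ∀ a, tensorD f i (Finsupp.single a 1) ∈
      Ideal.span (Set.range f) • (⊤ : Submodule S ((Fin i → Fin n) →₀ S)) by
    induction x using Finsupp.induction_linear with
    | zero => simp
    | add x y hx hy => rw [map_add]; exact add_mem hx hy
    | single a r =>
      rw [← mul_one r, ← smul_eq_mul, ← Finsupp.smul_single, map_smul]
      exact Submodule.smul_mem _ _ (h a)
  clear x
  have hf : ∀ (i : ℕ) (j : Fin n) (y : (Fin i → Fin n) →₀ S), f j • y ∈
      Ideal.span (Set.range f) • (⊤ : Submodule S ((Fin i → Fin n) →₀ S)) :=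
    fun i j y => Submodule.smul_mem_smul (Ideal.subset_span ⟨j, rfl⟩) trivial
  induction i with
  | zero => exact fun a => by rw [tensorD_zero_single]; exact hf _ _ _
  | succ i ih =>
    intro a
    rw [tensorD_succ_single]
    refine sub_mem (hf _ _ _) ?_
    have h1 := Submodule.mem_map_of_mem (f := Finsupp.lmapDomain S S
      (Fin.cons (α := fun _ => Fin n) (a 0))) (ih (Fin.tail a))
    rw [Submodule.map_smul''] at h1
    exact Submodule.smul_mono le_rfl le_top h1

end TensorComplex

/-! ### Acyclic targets and the canonical map to them. -/

/-- An acyclic complex of `S`-modules with the operators of a Koszul complex on `f₀, …, f_{n-1}`,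
the `0`-th homology of which is killed by `I` on the class of `one`. The submodule `N` contains the
boundaries and the multiples of elements of `J`. -/
structure KoszulTarget {S : Type*} [CommRing S] {n : ℕ} (f : Fin n → S) (I J : Ideal S)
    (L : Type*) [AddCommGroup L] [Module S L] where
  d : L →ₗ[S] L
  e : Fin n → L →ₗ[S] L
  part : ℕ → Submodule S L
  one : L
  N : Submodule S L
  one_mem : one ∈ part 0
  d_one : d one = 0
  d_e : ∀ j x, d (e j x) = f j • x - e j (d x)
  e_mem : ∀ j i, ∀ x ∈ part i, e j x ∈ part (i + 1)
  exact : ∀ i, ∀ x ∈ part (i + 1), d x = 0 → ∃ y ∈ part (i + 2), d y = x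
  exact_zero : ∀ p ∈ I, ∃ y ∈ part 1, d y = p • one
  d_mem : ∀ x, d x ∈ N
  smul_mem : ∀ p ∈ J, ∀ x, p • x ∈ N

namespace KoszulTarget

variable {S : Type*} [CommRing S] {n : ℕ} {f : Fin n → S} {I J : Ideal S}
  {L : Type*} [AddCommGroup L] [Module S L] (T : KoszulTarget f I J L)

/-- The map from the tensor algebra taking a word to the product of its letters. -/
def wordMap : ∀ i : ℕ, ((Fin i → Fin n) →₀ S) →ₗ[S] L
  | 0 => Finsupp.linearCombination S fun _ => T.one
  | i + 1 => Finsupp.linearCombination S fun a =>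
      T.e (a 0) (wordMap i (Finsupp.single (Fin.tail a) 1))

theorem wordMap_zero_single (a : Fin 0 → Fin n) :
    T.wordMap 0 (Finsupp.single a 1) = T.one := by
  simp [wordMap]

theorem wordMap_succ_single {i : ℕ} (a : Fin (i + 1) → Fin n) :
    T.wordMap (i + 1) (Finsupp.single a 1) =
      T.e (a 0) (T.wordMap i (Finsupp.single (Fin.tail a) 1)) := by
  simp [wordMap]

theorem wordMap_cons {i : ℕ} (j : Fin n) (x : (Fin i → Fin n) →₀ S) :
    T.wordMap (i + 1) (Finsupp.lmapDomain S S (Fin.cons (α := fun _ => Fin n) j) x) =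
      T.e j (T.wordMap i x) := by
  suffices h : T.wordMap (i + 1) ∘ₗ Finsupp.lmapDomain S S (Fin.cons (α := fun _ => Fin n) j) =
      T.e j ∘ₗ T.wordMap i from LinearMap.congr_fun h x
  ext1 a
  ext1
  simp only [LinearMap.comp_apply, Finsupp.lsingle_apply, Finsupp.lmapDomain_apply,
    Finsupp.mapDomain_single]
  rw [wordMap_succ_single]
  simp

/-- Source and target satisfy the same Leibniz rule, so the canonical map is a chain map. -/
theorem d_wordMap {i : ℕ} (x : (Fin (i + 1) → Fin n) →₀ S) :
    T.d (T.wordMap (i + 1) x) = T.wordMap i (tensorD f i x) := by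
  suffices h : T.d ∘ₗ T.wordMap (i + 1) = T.wordMap i ∘ₗ tensorD f i from
    LinearMap.congr_fun h x
  clear x
  induction i with
  | zero =>
    ext1 a
    ext1
    simp only [LinearMap.comp_apply, Finsupp.lsingle_apply]
    rw [tensorD_zero_single, wordMap_succ_single, map_smul, wordMap_zero_single, T.d_e, T.d_one,
      map_zero, sub_zero]
  | succ i ih =>
    ext1 a
    ext1
    simp only [LinearMap.comp_apply, Finsupp.lsingle_apply]
    rw [tensorD_succ_single, wordMap_succ_single, T.d_e, map_sub, map_smul, wordMap_cons,
      show T.d (T.wordMap (i + 1) _) = T.wordMap i (tensorD f i _) from LinearMap.congr_fun ih _]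

theorem wordMap_mem {i : ℕ} (x : (Fin i → Fin n) →₀ S) : T.wordMap i x ∈ T.part i := by
  suffices h : ∀ a, T.wordMap i (Finsupp.single a 1) ∈ T.part i by
    induction x using Finsupp.induction_linear with
    | zero => simp
    | add x y hx hy => rw [map_add]; exact add_mem hx hy
    | single a r =>
      rw [← mul_one r, ← smul_eq_mul, ← Finsupp.smul_single, map_smul]
      exact Submodule.smul_mem _ _ (h a)
  induction i with
  | zero => exact fun a => by rw [wordMap_zero_single]; exact T.one_mem
  | succ i ih => exact fun a => by rw [wordMap_succ_single]; exact T.e_mem _ _ _ (ih 0 _)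

end KoszulTarget

/-! ### Comparison of the tensor complex, the resolution and the target. -/

section Comparison

variable {K : Type*} [Field K] {σ : Type*} {I : Ideal (MvPolynomial σ K)}

theorem smul_mem_gradedFreePart {r : ℕ} {deg : Fin r → ℤ} {e e' : ℤ} {p : MvPolynomial σ K}
    (hp : p.IsWeightedHomogeneous (fun _ : σ => (1 : ℤ)) e') {v : Fin r → MvPolynomial σ K}
    (hv : v ∈ gradedFreePart K σ deg e) : p • v ∈ gradedFreePart K σ deg (e + e') := by
  refine mem_gradedFreePart.2 fun k => ?_
  have := hp.mul (mem_gradedFreePart.1 hv k)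
  rwa [show e' + (e - deg k) = e + e' - deg k by ring] at this

/-- The words carry no grading of their own; degrees are read off through `φ`. The induction varies
`φ`, precomposing it with the prefixing of a letter. -/
theorem map_tensorD_mem_gradedFreePart {n : ℕ} {f : Fin n → MvPolynomial σ K}
    (hf : ∀ j, (f j).IsWeightedHomogeneous (fun _ : σ => (1 : ℤ)) 2) {r : ℕ} {deg : Fin r → ℤ}
    {e : ℤ} (i : ℕ) (φ : ((Fin i → Fin n) →₀ MvPolynomial σ K) →ₗ[MvPolynomial σ K]
      (Fin r → MvPolynomial σ K))
    (hφ : ∀ a, φ (Finsupp.single a 1) ∈ gradedFreePart K σ deg e) (a : Fin (i + 1) → Fin n) :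
    φ (tensorD f i (Finsupp.single a 1)) ∈ gradedFreePart K σ deg (e + 2) := by
  induction i with
  | zero =>
    rw [tensorD_zero_single, map_smul]
    exact smul_mem_gradedFreePart (hf _) (hφ _)
  | succ i ih =>
    rw [tensorD_succ_single, map_sub, map_smul]
    refine sub_mem (smul_mem_gradedFreePart (hf _) (hφ _)) ?_
    refine ih (φ ∘ₗ Finsupp.lmapDomain (MvPolynomial σ K) (MvPolynomial σ K)
      (Fin.cons (α := fun _ => Fin n) (a 0))) (fun b => ?_) _
    simpa using hφ _

/-- The step `i` of the comparison of the Koszul complex with a resolution `F` and with an acyclic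
target: a chain map `φ` to `F`, a chain map `ψ` from `F`, and a homotopy `h` from their composite to
the canonical map. -/
def ComparisonStep {n : ℕ} {f : Fin n → MvPolynomial σ K}
    (F : MinimalGradedFreeResolution (σ := σ) (quotientGrading I))
    {L : Type*} [AddCommGroup L] [Module (MvPolynomial σ K) L]
    (T : KoszulTarget f I (Ideal.span (Set.range X)) L) (i : ℕ) : Prop :=
  ∃ (φ : ((Fin i → Fin n) →₀ MvPolynomial σ K) →ₗ[MvPolynomial σ K]
      (Fin (F.rank i) → MvPolynomial σ K))
    (ψ : (Fin (F.rank i) → MvPolynomial σ K) →ₗ[MvPolynomial σ K] L)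
    (h : ((Fin i → Fin n) →₀ MvPolynomial σ K) →ₗ[MvPolynomial σ K] L),
    (∀ a, φ (Finsupp.single a 1) ∈ gradedFreePart K σ (F.deg i) (2 * i)) ∧
    (∀ x, ∃ v, F.d i v = φ (tensorD f i x)) ∧
    (∀ v, ψ v ∈ T.part i) ∧
    (∀ v, ∃ y ∈ T.part (i + 1), T.d y = ψ (F.d i v)) ∧
    (∀ x, h x ∈ T.part (i + 1)) ∧
    (∀ x, ψ (φ (tensorD f i x)) - T.wordMap i (tensorD f i x) = T.d (h (tensorD f i x))) ∧
    ∀ x, ψ (φ x) - T.wordMap i x ∈ T.N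

theorem linearCombination_mem {R α M : Type*} [CommRing R] [AddCommGroup M]
    [Module R M] {v : α → M} {N : Submodule R M} (hv : ∀ a, v a ∈ N) (x : α →₀ R) :
    Finsupp.linearCombination R v x ∈ N := by
  rw [Finsupp.linearCombination_apply]
  exact Submodule.sum_mem _ fun a _ => N.smul_mem _ (hv a)

theorem fintypeLinearCombination_mem {R α M : Type*} [Fintype α] [CommRing R] [AddCommGroup M]
    [Module R M] {v : α → M} {N : Submodule R M} (hv : ∀ a, v a ∈ N) (x : α → R) :
    Fintype.linearCombination R v x ∈ N := by
  rw [Fintype.linearCombination_apply]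
  exact Submodule.sum_mem _ fun a _ => N.smul_mem _ (hv a)

theorem finsupp_congr_of_single {R α M : Type*} [CommRing R] [AddCommGroup M] [Module R M]
    {g g' : (α →₀ R) →ₗ[R] M} (h : ∀ a, g (Finsupp.single a 1) = g' (Finsupp.single a 1))
    (x : α →₀ R) : g x = g' x := by
  have : g = g' := by
    ext1 a
    ext1
    exact h a
  rw [this]

theorem pi_congr_of_single {R α M : Type*} [Finite α] [DecidableEq α] [CommRing R] [AddCommGroup M]
    [Module R M] {g g' : (α → R) →ₗ[R] M} (h : ∀ a, g (Pi.single a 1) = g' (Pi.single a 1))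
    (x : α → R) : g x = g' x := by
  have : g = g' := by
    refine LinearMap.pi_ext' fun a => ?_
    ext1
    exact h a
  rw [this]

variable {n : ℕ} {f : Fin n → MvPolynomial σ K}
    (F : MinimalGradedFreeResolution (σ := σ) (quotientGrading I))
    {L : Type*} [AddCommGroup L] [Module (MvPolynomial σ K) L]
    (T : KoszulTarget f I (Ideal.span (Set.range X)) L)

/-- `φ` sends the empty word to a degree `0` lift `u` of `1`, and `ψ` is a lift `P` of the
augmentation to the polynomial ring, times `T.one`. As `P u - 1 ∈ I`, the difference from the
canonical map is a boundary `d b`, which is the homotopy. -/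
theorem comparisonStep_zero
    (hI : ∀ p ∈ I, ∀ e : ℤ, weightedHomogeneousComponent (fun _ : σ => (1 : ℤ)) e p ∈ I)
    (hfI : ∀ j, f j ∈ I) : ComparisonStep F T 0 := by
  obtain ⟨u, hu, hu1⟩ := F.exists_aug_eq_one hI
  have haug : ∀ k, ∃ p : MvPolynomial σ K, Ideal.Quotient.mk I p = F.aug (Pi.single k 1) :=
    fun k => Ideal.Quotient.mk_surjective _
  choose p hp using haug
  let P := Fintype.linearCombination (MvPolynomial σ K) p
  have hP : ∀ v, Ideal.Quotient.mk I (P v) = F.aug v := by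
    refine pi_congr_of_single (g := (Submodule.mkQ I) ∘ₗ P) fun k => ?_
    rw [LinearMap.comp_apply, ← hp k]
    simp [P]
  have hPI : ∀ v, F.aug v = 0 → P v ∈ I := fun v hv => by
    rw [← Ideal.Quotient.eq_zero_iff_mem, hP, hv]
  obtain ⟨b, hb, hdb⟩ := T.exact_zero (P u - 1) (by
    rw [← Ideal.Quotient.eq_zero_iff_mem, map_sub, hP, hu1, map_one, sub_self])
  have hh : ∀ x, P.smulRight T.one
      (Finsupp.linearCombination (MvPolynomial σ K) (fun _ : Fin 0 → Fin n => u) x) -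
      T.wordMap 0 x = T.d (Finsupp.linearCombination (MvPolynomial σ K)
        (fun _ : Fin 0 → Fin n => b) x) := by
    refine finsupp_congr_of_single (g := P.smulRight T.one ∘ₗ
      Finsupp.linearCombination (MvPolynomial σ K) (fun _ : Fin 0 → Fin n => u) - T.wordMap 0)
      (g' := T.d ∘ₗ Finsupp.linearCombination (MvPolynomial σ K) (fun _ => b)) fun a => ?_
    simp only [LinearMap.sub_apply, LinearMap.comp_apply, Finsupp.linearCombination_single,
      one_smul, KoszulTarget.wordMap_zero_single, hdb, sub_smul, LinearMap.smulRight_apply]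
  refine ⟨Finsupp.linearCombination _ fun _ => u, P.smulRight T.one,
    Finsupp.linearCombination _ fun _ => b, fun a => ?_, fun x => ?_, fun v => ?_, fun v => ?_,
    linearCombination_mem fun _ => hb, fun x => hh _, fun x => ?_⟩
  · simpa using hu
  · refine (F.exact_aug _).1 ?_
    have h0 : ∀ x, F.aug (Finsupp.linearCombination (MvPolynomial σ K)
        (fun _ : Fin 0 → Fin n => u) (tensorD f 0 x)) = 0 := by
      refine finsupp_congr_of_single (g := F.aug ∘ₗ Finsupp.linearCombination (MvPolynomial σ K)
        (fun _ : Fin 0 → Fin n => u) ∘ₗ tensorD f 0) (g' := 0) fun a => ?_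
      simp only [LinearMap.comp_apply, tensorD_zero_single, map_smul,
        Finsupp.linearCombination_single, one_smul, hu1, LinearMap.zero_apply]
      change Ideal.Quotient.mk I (f (a 0) * 1) = 0
      rw [mul_one, Ideal.Quotient.eq_zero_iff_mem]
      exact hfI _
    exact h0 x
  · exact Submodule.smul_mem _ _ T.one_mem
  · exact T.exact_zero _ (hPI _ ((F.exact_aug _).2 ⟨v, rfl⟩))
  · rw [hh]
    exact T.d_mem _

/-- `ComparisonStep` records its compatibilities on boundaries only, which is exactly what the next
lifts require, so the induction never refers to earlier maps. -/
theorem comparisonStep_succ (hf : ∀ j, (f j).IsWeightedHomogeneous (fun _ : σ => (1 : ℤ)) 2)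
    (hfX : ∀ j, f j ∈ Ideal.span (Set.range (X : σ → MvPolynomial σ K)))
    {i : ℕ} (hstep : ComparisonStep F T i) : ComparisonStep F T (i + 1) := by
  obtain ⟨φ, ψ, h, hφ, hφd, hψ, hψd, hh, hhom, -⟩ := hstep
  choose u hu using fun a : Fin (i + 1) → Fin n => hφd (Finsupp.single a 1)
  -- An arbitrary lift is projected to degree `2 (i + 1)`; it stays a lift because its target is
  -- homogeneous of that degree.
  let φ' := Finsupp.linearCombination (MvPolynomial σ K) fun a =>
    gradedFreeProj (F.deg (i + 1)) (2 * (i + 1 : ℕ)) (u a)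
  have hdφ' : ∀ x, F.d i (φ' x) = φ (tensorD f i x) := by
    refine finsupp_congr_of_single (g := F.d i ∘ₗ φ') (g' := φ ∘ₗ tensorD f i) fun a => ?_
    simp only [φ', LinearMap.comp_apply, Finsupp.linearCombination_single, one_smul]
    rw [map_gradedFreeProj_of_homogeneous _ (F.d_homogeneous i), hu]
    refine gradedFreeProj_of_mem ?_
    have := map_tensorD_mem_gradedFreePart hf i φ hφ a
    rwa [show (2 * (i : ℤ) + 2) = 2 * (i + 1 : ℕ) by push_cast; ring] at this
  choose b hb hdb using fun k : Fin (F.rank (i + 1)) => hψd (Pi.single k 1)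
  let ψ' := Fintype.linearCombination (MvPolynomial σ K) b
  have hψ' : ∀ v, ψ' v ∈ T.part (i + 1) := fintypeLinearCombination_mem hb
  have hdψ' : ∀ v, T.d (ψ' v) = ψ (F.d i v) := by
    refine pi_congr_of_single (g := T.d ∘ₗ ψ') (g' := ψ ∘ₗ F.d i) fun k => ?_
    rw [LinearMap.comp_apply, LinearMap.comp_apply, ← hdb]
    simp [ψ']
  have hex : ∀ a : Fin (i + 1) → Fin n, ∃ y ∈ T.part (i + 1 + 1), T.d y =
      ψ' (φ' (Finsupp.single a 1)) - T.wordMap (i + 1) (Finsupp.single a 1) -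
        h (tensorD f i (Finsupp.single a 1)) := by
    intro a
    refine T.exact i _ (sub_mem (sub_mem (hψ' _) (T.wordMap_mem _)) (hh _)) ?_
    rw [map_sub, map_sub, hdψ', hdφ', T.d_wordMap, hhom, sub_self]
  choose c hc hdc using hex
  let h' := Finsupp.linearCombination (MvPolynomial σ K) c
  have hdh' : ∀ x, T.d (h' x) = ψ' (φ' x) - T.wordMap (i + 1) x - h (tensorD f i x) := by
    refine finsupp_congr_of_single (g := T.d ∘ₗ h')
      (g' := ψ' ∘ₗ φ' - T.wordMap (i + 1) - h ∘ₗ tensorD f i) fun a => ?_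
    simp only [LinearMap.comp_apply, LinearMap.sub_apply, ← hdc]
    simp [h']
  refine ⟨φ', ψ', h', fun a => ?_, fun x => ?_, hψ', fun v => ?_, linearCombination_mem hc,
    fun x => ?_, fun x => ?_⟩
  · simp only [φ', Finsupp.linearCombination_single, one_smul]
    exact gradedFreeProj_mem _ _ _
  · refine (F.exact_d i _).1 ?_
    rw [hdφ', tensorD_tensorD, map_zero]
  · refine T.exact i _ (hψ' _) ?_
    rw [hdψ', (F.exact_d i _).2 ⟨v, rfl⟩, map_zero]
  · rw [hdh', tensorD_tensorD, map_zero, sub_zero]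
  -- Both homotopy terms lie in `N`: one is a boundary, the other is `h` of a combination with
  -- coefficients in the ideal of the `f j`.
  · have h1 : ψ' (φ' x) - T.wordMap (i + 1) x = T.d (h' x) + h (tensorD f i x) := by
      rw [hdh', sub_add_cancel]
    rw [h1]
    refine add_mem (T.d_mem _) ?_
    have h2 := Submodule.mem_map_of_mem (f := h) (tensorD_mem f x)
    rw [Submodule.map_smul''] at h2
    refine Submodule.smul_le.2 (fun p hp y _ => T.smul_mem p ?_ y) h2
    exact (Ideal.span_le.2 (by rintro _ ⟨j, rfl⟩; exact hfX j)) hp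

/-- If the top Koszul class is nonzero in the target modulo `N`, then the `n`-th module of the
resolution has a basis element of degree `2 * n`. -/
theorem exists_deg_eq_of_koszulTarget
    (hI : ∀ p ∈ I, ∀ e : ℤ, weightedHomogeneousComponent (fun _ : σ => (1 : ℤ)) e p ∈ I)
    (hfI : ∀ j, f j ∈ I) (hf : ∀ j, (f j).IsWeightedHomogeneous (fun _ : σ => (1 : ℤ)) 2)
    (hfX : ∀ j, f j ∈ Ideal.span (Set.range (X : σ → MvPolynomial σ K)))
    (a : Fin n → Fin n) (ha : T.wordMap n (Finsupp.single a 1) ∉ T.N) :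
    ∃ k, F.deg n k = 2 * n := by
  have hstep : ∀ i, ComparisonStep F T i := fun i => by
    induction i with
    | zero => exact comparisonStep_zero F T hI hfI
    | succ i ih => exact comparisonStep_succ F T hf hfX ih
  obtain ⟨φ, ψ, h, hφ, -, -, -, -, -, hN⟩ := hstep n
  -- Without a basis element of degree `2 * n`, every coordinate of the image of the top word lies
  -- in the ideal of the variables; then `ψ` maps it into `N`, and the canonical image lies in `N`
  -- too.
  by_contra! hdeg
  have hmem : ∀ k, φ (Finsupp.single a 1) k ∈
      Ideal.span (Set.range (X : σ → MvPolynomial σ K)) := by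
    intro k
    by_contra hk
    exact hdeg k (eq_of_mem_gradedFreePart_of_notMem (hφ a) hk)
  have hψN : ψ (φ (Finsupp.single a 1)) ∈ T.N := by
    rw [pi_eq_sum_univ' (φ (Finsupp.single a 1)), map_sum]
    refine Submodule.sum_mem _ fun k _ => ?_
    rw [map_smul]
    exact T.smul_mem _ (hmem k) _
  refine ha ?_
  have := sub_mem hψN (hN (Finsupp.single a 1))
  rwa [sub_sub_cancel] at this

end Comparison

/-! ### The Koszul complex over an algebra as a target. -/

section Specialization

variable {K : Type*} [Field K] {σ : Type*} {I : Ideal (MvPolynomial σ K)}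

theorem prod_map_cons_mulVec {R T : Type*} [CommRing R] [Fintype T] [DecidableEq T] {n : ℕ} (i : ℕ)
    (e : Fin n → Matrix T T R) (a : Fin (i + 1) → Fin n) (v : T → R) :
    ((List.ofFn a).map e).prod.mulVec v =
      (e (a 0)).mulVec (((List.ofFn (Fin.tail a)).map e).prod.mulVec v) := by
  rw [List.ofFn_succ, List.map_cons, List.prod_cons, Matrix.mulVec_mulVec]
  rfl

open scoped Matrix.Module in
theorem KoszulMatrices.d_smul_single_bot {R : Type*} [CommRing R] {n : ℕ} {f : Fin n → R}
    (k : KoszulMatrices f) : k.d • (Pi.single k.bot 1 : k.T → R) = 0 := by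
  have h0 : k.IsChain 0 (Pi.single k.bot 1 : k.T → R) :=
    fun t ht => Pi.single_eq_of_ne (fun h => ht ((k.deg_eq_zero t).2 h)) _
  ext s
  rw [Matrix.Module.smul_apply]
  refine Finset.sum_eq_zero fun t _ => ?_
  by_cases h : k.d s t = 0
  · rw [h, zero_smul]
  · rw [h0 t (by have := k.deg_d s t h; omega), smul_zero]

variable {n : ℕ} {f : Fin n → MvPolynomial σ K} {R : Type*} [CommRing R]
  [Algebra (MvPolynomial σ K) R]

open scoped Matrix.Module in
/-- The Koszul complex over an `S`-algebra `R` as a target of comparison, if the images of the `f j`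
generate an ideal containing the image of `I` and a regular sequence of length `n`. -/
def KoszulMatrices.target (k : KoszulMatrices fun j => algebraMap (MvPolynomial σ K) R (f j))
    (gs : List R)
    (hgs : ∀ g ∈ gs, g ∈ Ideal.span (Set.range fun j => algebraMap (MvPolynomial σ K) R (f j)))
    (hlen : gs.length = n) (hreg : RingTheory.Sequence.IsWeaklyRegular R gs)
    (hI : ∀ p ∈ I, algebraMap (MvPolynomial σ K) R p ∈
      Ideal.span (Set.range fun j => algebraMap (MvPolynomial σ K) R (f j)))
    (hfX : ∀ j, f j ∈ Ideal.span (Set.range (X : σ → MvPolynomial σ K))) :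
    KoszulTarget f I (Ideal.span (Set.range X)) (k.T → R) where
  d := k.d.mulVecLin.restrictScalars _
  e j := (k.e j).mulVecLin.restrictScalars _
  part i :=
    { carrier := {c | k.IsChain i c}
      add_mem' := fun {a b} ha hb t ht => by simp [ha t ht, hb t ht]
      zero_mem' := fun _ _ => rfl
      smul_mem' := fun r c hc t ht => by simp [hc t ht] }
  one := Pi.single k.bot 1
  N := Submodule.pi Set.univ fun _ =>
    ((Ideal.span (Set.range X)).map (algebraMap (MvPolynomial σ K) R)).restrictScalars _
  one_mem := fun t ht => Pi.single_eq_of_ne (fun h => ht ((k.deg_eq_zero t).2 h)) _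
  d_one := k.d_smul_single_bot
  d_e j x := (k.d_smul_e_smul j x).trans (by rw [algebraMap_smul]; rfl)
  e_mem j i x hx := k.isChain_e_smul hx j
  exact i x hx hdx :=
    k.exists_d_smul_eq_of_isWeaklyRegular gs hgs hreg (i + 1) x hx (by omega) hdx
  exact_zero p hp := by
    obtain ⟨b, hb, hdb⟩ := k.exists_d_smul_eq_of_mem_span (M := R) (hI p hp) (i := 0)
      (c := Pi.single k.bot 1)
      (fun t ht => Pi.single_eq_of_ne (fun h => ht ((k.deg_eq_zero t).2 h)) _) k.d_smul_single_bot
    exact ⟨b, hb, hdb.trans (algebraMap_smul R p _)⟩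
  d_mem x s _ := by
    refine Ideal.sum_mem _ fun t _ => Ideal.mul_mem_right _ _ ?_
    refine Ideal.span_le.2 ?_ (k.d_mem s t)
    rintro _ ⟨j, rfl⟩
    exact Ideal.mem_map_of_mem _ (hfX j)
  smul_mem p hp x s _ := by
    rw [Pi.smul_apply, Algebra.smul_def]
    exact Ideal.mul_mem_right _ _ (Ideal.mem_map_of_mem _ hp)

/-- A lower bound for the degrees in a minimal graded free resolution: quadrics `f₀, …, f_{n-1}` in
`I` whose images in some algebra generate the image of `I` and have depth `n` there contribute a
basis element of degree `2 * n` in homological degree `n`. -/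
theorem exists_deg_eq_of_isWeaklyRegular
    (hI : ∀ p ∈ I, ∀ e : ℤ, weightedHomogeneousComponent (fun _ : σ => (1 : ℤ)) e p ∈ I)
    (F : MinimalGradedFreeResolution (σ := σ) (quotientGrading I))
    (hfI : ∀ j, f j ∈ I) (hf : ∀ j, (f j).IsWeightedHomogeneous (fun _ : σ => (1 : ℤ)) 2)
    (hfX : ∀ j, f j ∈ Ideal.span (Set.range (X : σ → MvPolynomial σ K)))
    (gs : List R)
    (hgs : ∀ g ∈ gs, g ∈ Ideal.span (Set.range fun j => algebraMap (MvPolynomial σ K) R (f j)))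
    (hlen : gs.length = n) (hreg : RingTheory.Sequence.IsWeaklyRegular R gs)
    (hIR : ∀ p ∈ I, algebraMap (MvPolynomial σ K) R p ∈
      Ideal.span (Set.range fun j => algebraMap (MvPolynomial σ K) R (f j)))
    (htop : (Ideal.span (Set.range X)).map (algebraMap (MvPolynomial σ K) R) ≠ ⊤) :
    ∃ k, F.deg n k = 2 * n := by
  obtain ⟨k⟩ := nonempty_koszulMatrices fun j => algebraMap (MvPolynomial σ K) R (f j)
  obtain ⟨a, t, hat⟩ := k.exists_top
  let T := k.target gs hgs hlen hreg hIR hfX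
  have hword : ∀ (i : ℕ) (b : Fin i → Fin n), T.wordMap i (Finsupp.single b 1) =
      ((List.ofFn b).map k.e).prod.mulVec (Pi.single k.bot 1) := by
    intro i
    induction i with
    | zero =>
      intro b
      rw [T.wordMap_zero_single, List.ofFn_zero, List.map_nil, List.prod_nil, Matrix.one_mulVec]
      rfl
    | succ i ih =>
      intro b
      rw [T.wordMap_succ_single, ih, prod_map_cons_mulVec]
      rfl
  -- The top word has coordinate `1` at `t`, so lying in `N` would put `1` in the extended ideal of
  -- the variables.
  refine exists_deg_eq_of_koszulTarget F T hI hfI hf hfX a fun h => htop ?_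
  rw [hword] at h
  have h1 := h t trivial
  rw [Matrix.mulVec_single_one, Matrix.col_apply, hat] at h1
  exact (Ideal.eq_top_iff_one _).2 h1

end Specialization

/-! ### Induced subgraphs and specializations of their variables. -/

section ParityBinomialEdgeIdeal

variable {K : Type*} [Field K] {V : Type*}

theorem isWeightedHomogeneous_parityBinomial (i j : V) :
    (X (Sum.inl i) * X (Sum.inl j) - X (Sum.inr i) * X (Sum.inr j) :
      MvPolynomial (V ⊕ V) K).IsWeightedHomogeneous (fun _ => (1 : ℤ)) 2 := by
  have hX : ∀ a b : V ⊕ V, (X a * X b : MvPolynomial (V ⊕ V) K).IsWeightedHomogeneous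
      (fun _ => (1 : ℤ)) 2 := fun a b =>
    (isWeightedHomogeneous_X K (fun _ : V ⊕ V => (1 : ℤ)) a).mul
      (isWeightedHomogeneous_X K (fun _ : V ⊕ V => (1 : ℤ)) b)
  exact (hX _ _).sub (hX _ _)

theorem parityBinomial_mem_span_range_X (i j : V) :
    (X (Sum.inl i) * X (Sum.inl j) - X (Sum.inr i) * X (Sum.inr j) : MvPolynomial (V ⊕ V) K) ∈
      Ideal.span (Set.range (X : V ⊕ V → MvPolynomial (V ⊕ V) K)) :=
  sub_mem (Ideal.mul_mem_right _ _ (Ideal.subset_span ⟨_, rfl⟩))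
    (Ideal.mul_mem_right _ _ (Ideal.subset_span ⟨_, rfl⟩))

theorem parityBinomialEdgeIdeal_le_span_range_X (G : SimpleGraph V) :
    parityBinomialEdgeIdeal K G ≤ Ideal.span (Set.range X) := by
  refine Ideal.span_le.2 ?_
  rintro _ ⟨i, j, -, rfl⟩
  exact parityBinomial_mem_span_range_X i j

theorem weightedHomogeneousComponent_mem_parityBinomialEdgeIdeal (G : SimpleGraph V) :
    ∀ p ∈ parityBinomialEdgeIdeal K G, ∀ e : ℤ,
      weightedHomogeneousComponent (fun _ : V ⊕ V => (1 : ℤ)) e p ∈ parityBinomialEdgeIdeal K G := by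
  let _ := weightedGradedAlgebra K (fun _ : V ⊕ V => (1 : ℤ))
  intro p hp e
  refine weightedHomogeneousComponent_mem_of_mem K (fun _ => (1 : ℤ)) ?_ hp e
  refine Ideal.homogeneous_span _ _ ?_
  rintro _ ⟨i, j, -, rfl⟩
  exact ⟨2, isWeightedHomogeneous_parityBinomial i j⟩

/-- A lower bound for the regularity from an induced subgraph `H` with `n` edges `s j`, `t j`, and a
specialization of its variables to polynomials `p`, `q` in `n` variables under which the generators
have only the trivial common zero. -/
theorem le_regularity_of_embedding [Finite V] {G : SimpleGraph V} {W : Type*} {H : SimpleGraph W}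
    (ι : H ↪g G) {n : ℕ} (s t : Fin n → W) (hadj : ∀ j, H.Adj (s j) (t j))
    (hcover : ∀ a b, H.Adj a b → ∃ j, s j = a ∧ t j = b ∨ s j = b ∧ t j = a)
    (p q : W → MvPolynomial (Fin n) K)
    (hp : ∀ a, p a ∈ Ideal.span (Set.range (X : Fin n → MvPolynomial (Fin n) K)))
    (hq : ∀ a, q a ∈ Ideal.span (Set.range (X : Fin n → MvPolynomial (Fin n) K)))
    (hzero : ∀ P : Ideal (MvPolynomial (Fin n) K), P.IsPrime →
      (∀ j, p (s j) * p (t j) - q (s j) * q (t j) ∈ P) → ∀ j, X j ∈ P) :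
    (n : EReal) ≤ regularity (V ⊕ V) (quotientGrading (parityBinomialEdgeIdeal K G)) := by
  classical
  -- Vertices outside `H` get the value `0`, so every edge of `G` meeting the outside contributes
  -- `0`; the remaining edges are edges of `H` because `ι` is an induced embedding.
  let p' : V → MvPolynomial (Fin n) K := Function.extend ι p 0
  let q' : V → MvPolynomial (Fin n) K := Function.extend ι q 0
  have hp' : ∀ a, p' (ι a) = p a := ι.injective.extend_apply p 0
  have hq' : ∀ a, q' (ι a) = q a := ι.injective.extend_apply q 0
  have hp0 : ∀ v, (¬ ∃ a, ι a = v) → p' v = 0 := fun v hv => 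
    Function.extend_apply' p (0 : V → MvPolynomial (Fin n) K) v hv
  have hq0 : ∀ v, (¬ ∃ a, ι a = v) → q' v = 0 := fun v hv => 
    Function.extend_apply' q (0 : V → MvPolynomial (Fin n) K) v hv
  let _ : Algebra (MvPolynomial (V ⊕ V) K) (MvPolynomial (Fin n) K) :=
    (aeval (Sum.elim p' q') : MvPolynomial (V ⊕ V) K →ₐ[K] _).toRingHom.toAlgebra
  have hmap : ∀ x, algebraMap (MvPolynomial (V ⊕ V) K) (MvPolynomial (Fin n) K) x =
      aeval (Sum.elim p' q') x := fun _ => rfl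
  let f : Fin n → MvPolynomial (V ⊕ V) K := fun j =>
    X (Sum.inl (ι (s j))) * X (Sum.inl (ι (t j))) - X (Sum.inr (ι (s j))) * X (Sum.inr (ι (t j)))
  have hmapf : ∀ j, algebraMap (MvPolynomial (V ⊕ V) K) (MvPolynomial (Fin n) K) (f j) =
      p (s j) * p (t j) - q (s j) * q (t j) := fun j => by
    simp [hmap, f, hp', hq']
  have hI := weightedHomogeneousComponent_mem_parityBinomialEdgeIdeal (K := K) G
  have hne := nonempty_minimalGradedFreeResolution _ hI (parityBinomialEdgeIdeal_le_span_range_X G)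
  have hrad : ∀ j, ∃ N : ℕ, (X j : MvPolynomial (Fin n) K) ^ N ∈
      Ideal.span (Set.range fun j => algebraMap (MvPolynomial (V ⊕ V) K) _ (f j)) := by
    intro j
    change X j ∈ Ideal.radical _
    -- The radical is the intersection of the primes above, which turns `hzero` into powers of the
    -- variables in the ideal.
    rw [Ideal.radical_eq_sInf, Submodule.mem_sInf]
    rintro P ⟨hle, hP⟩
    exact hzero P hP (fun j => by rw [← hmapf]; exact hle (Ideal.subset_span ⟨j, rfl⟩)) j
  choose N hN using hrad
  obtain ⟨k, hk⟩ := exists_deg_eq_of_isWeaklyRegular (f := f) (R := MvPolynomial (Fin n) K)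
    hI hne.some (fun j => Ideal.subset_span ⟨_, _, ι.map_rel_iff.2 (hadj j), rfl⟩)
    (fun j => isWeightedHomogeneous_parityBinomial _ _)
    (fun j => parityBinomial_mem_span_range_X _ _)
    (List.ofFn fun j => X j ^ N j) (by
      intro g hg
      obtain ⟨j, rfl⟩ := (List.mem_ofFn' _ _).1 hg
      exact hN j) (List.length_ofFn) (isWeaklyRegular_X_pow K N) (by
      intro x hx
      have hle : parityBinomialEdgeIdeal K G ≤ (Ideal.span (Set.range fun j =>
          algebraMap (MvPolynomial (V ⊕ V) K) (MvPolynomial (Fin n) K) (f j))).comap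
            (algebraMap (MvPolynomial (V ⊕ V) K) (MvPolynomial (Fin n) K)) := by
        refine Ideal.span_le.2 ?_
        rintro _ ⟨u, v, huv, rfl⟩
        rw [SetLike.mem_coe, Ideal.mem_comap, hmap]
        simp only [map_sub, map_mul, aeval_X, Sum.elim_inl, Sum.elim_inr]
        by_cases hu : ∃ a, ι a = u
        · by_cases hv : ∃ b, ι b = v
          · obtain ⟨a, rfl⟩ := hu
            obtain ⟨b, rfl⟩ := hv
            obtain ⟨j, h⟩ := hcover a b (ι.map_rel_iff.1 huv)
            refine Ideal.subset_span ⟨j, ?_⟩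
            simp only [hmapf, hp', hq']
            rcases h with ⟨rfl, rfl⟩ | ⟨rfl, rfl⟩
            · rfl
            · ring
          · simp [hp0 v hv, hq0 v hv]
        · simp [hp0 u hu, hq0 u hu]
      exact hle hx) (by
      intro h
      have hle : (Ideal.span (Set.range X)).map
          (algebraMap (MvPolynomial (V ⊕ V) K) (MvPolynomial (Fin n) K)) ≤
            Ideal.span (Set.range X) := by
        rw [Ideal.map_le_iff_le_comap, Ideal.span_le]
        rintro _ ⟨v | v, rfl⟩
        · rw [SetLike.mem_coe, Ideal.mem_comap, hmap, aeval_X, Sum.elim_inl]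
          by_cases hv : ∃ a, ι a = v
          · obtain ⟨a, rfl⟩ := hv
            rw [hp']
            exact hp a
          · simp [hp0 v hv]
        · rw [SetLike.mem_coe, Ideal.mem_comap, hmap, aeval_X, Sum.elim_inr]
          by_cases hv : ∃ a, ι a = v
          · obtain ⟨a, rfl⟩ := hv
            rw [hq']
            exact hq a
          · simp [hq0 v hv]
      have h1 := hle (h ▸ Submodule.mem_top : (1 : MvPolynomial (Fin n) K) ∈ _)
      rw [mem_span_range_X_iff] at h1
      simp at h1)
  have hbetti : gradedBetti (V ⊕ V) (quotientGrading (parityBinomialEdgeIdeal K G)) n (2 * n) ≠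
      0 := by
    rw [gradedBetti, dif_pos hne]
    have : Nonempty {k : Fin (hne.some.rank n) // hne.some.deg n k = 2 * n} := ⟨⟨k, hk⟩⟩
    exact Nat.card_pos.ne'
  refine le_trans ?_ (le_iSup_of_le n (le_iSup_of_le (2 * n : ℤ) (le_iSup_of_le hbetti le_rfl)))
  rw [show (2 * n - n : ℤ) = n by ring]
  simp

/-! ### Linear forms for paths and odd cycles. -/

/-- The coordinates of the vertex `k` in the specialization of a path attached to a sequence `z`:
the columns of the matrix with rows `z (k + 1)` and `z k - γ z (k + 1)`, exchanging the rows at every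
other vertex. -/
def pathCoord {R : Type*} [CommRing R] (z : ℕ → R) (γ : R) (b : Prop) [Decidable b] (k : ℕ) : R :=
  if b then z (k + 1) else z k - γ * z (k + 1)

theorem pathCoord_mem {R : Type*} [CommRing R] {z : ℕ → R} {J : Ideal R} (hz : ∀ i, z i ∈ J) (γ : R)
    (b : Prop) [Decidable b] (k : ℕ) : pathCoord z γ b k ∈ J := by
  unfold pathCoord
  split_ifs
  · exact hz _
  · exact sub_mem (hz _) (J.mul_mem_left _ (hz _))

/-- The edge binomial is a `2 × 2` determinant, up to a sign depending on the parity of `k`, and the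
terms in `γ` cancel. Because of the sign the statement is about membership. -/
theorem pathCoord_edge_mem_iff {R : Type*} [CommRing R] (z : ℕ → R) (γ : R) (k : ℕ) (J : Ideal R) :
    pathCoord z γ (Even k) k * pathCoord z γ (Even (k + 1)) (k + 1) -
      pathCoord z γ (¬ Even k) k * pathCoord z γ (¬ Even (k + 1)) (k + 1) ∈ J ↔
        z (k + 1) ^ 2 - z k * z (k + 2) ∈ J := by
  by_cases h : Even k
  · have h' : ¬ Even (k + 1) := by simpa [Nat.even_add_one] using h
    simp only [pathCoord, h, h', not_true, not_false_iff, if_true, if_false]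
    ring_nf
  · have h' : Even (k + 1) := by simpa [Nat.even_add_one] using h
    simp only [pathCoord, h, h', not_true, not_false_iff, if_true, if_false]
    rw [← neg_mem_iff]
    ring_nf

theorem forall_eq_zero_of_sq_eq_mul {D : Type*} [CommRing D] [IsDomain D] {ζ : ℕ → D} {l : ℕ}
    {i₀ : ℕ} (h0 : ζ i₀ = 0) (h : ∀ i < l, i₀ ≤ i → ζ (i + 1) ^ 2 = ζ i * ζ (i + 2)) :
    ∀ i ≤ l, i₀ ≤ i → ζ i = 0 := by
  intro i hi hi0
  induction i, hi0 using Nat.le_induction with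
  | base => exact h0
  | succ i hi0 ih =>
    have := h i (by omega) hi0
    rw [ih (by omega), zero_mul] at this
    exact pow_eq_zero_iff (two_ne_zero) |>.1 this

/-- If `ζ 0` and `ζ 1` are nonzero, the `ζ i` form a geometric progression, so `ζ 0 * ζ (m + 2) = ζ
1 * ζ (m + 1)` and `hclose` reads `ζ (m + 1) * (2 * ζ 1 - ζ 0) = 0`. The second factor is `ζ (m +
2)`, also a nonzero term of the progression. No division by `2` occurs, so any characteristic is
allowed. -/
theorem forall_eq_zero_of_cycle {D : Type*} [CommRing D] [IsDomain D] {ζ : ℕ → D} {m : ℕ}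
    (hm : 1 ≤ m) (h : ∀ i < m + 1, ζ (i + 1) ^ 2 = ζ i * ζ (i + 2))
    (hlast : ζ (m + 2) = 2 * ζ 1 - ζ 0)
    (hclose : ζ 0 * ζ (m + 2) + ζ 1 * ζ (m + 1) - ζ 0 * ζ (m + 1) = 0) :
    ∀ i ≤ m + 1, ζ i = 0 := by
  by_cases h0 : ζ 0 = 0
  · exact fun i hi => forall_eq_zero_of_sq_eq_mul h0 (fun i hi _ => h i hi) i hi (Nat.zero_le i)
  exfalso
  by_cases h1 : ζ 1 = 0
  · have hm1 : ζ (m + 1) = 0 :=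
      forall_eq_zero_of_sq_eq_mul h1 (fun i hi _ => h i hi) (m + 1) le_rfl (by omega)
    rw [hm1, hlast, h1] at hclose
    have : ζ 0 * ζ 0 = 0 := by linear_combination -hclose
    exact h0 (mul_self_eq_zero.1 this)
  · have hratio : ∀ i ≤ m + 1, ζ i ≠ 0 ∧ ζ (i + 1) * ζ 0 = ζ i * ζ 1 := by
      intro i hi
      induction i with
      | zero => exact ⟨h0, mul_comm _ _⟩
      | succ i ih =>
        obtain ⟨hne, heq⟩ := ih (by omega)
        have hne' : ζ (i + 1) ≠ 0 := by
          intro hz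
          rw [hz, zero_mul] at heq
          exact mul_ne_zero hne h1 heq.symm
        refine ⟨hne', mul_left_cancel₀ hne ?_⟩
        linear_combination (-ζ 0) * h i (by omega) + ζ (i + 1) * heq
    obtain ⟨hne, heq⟩ := hratio (m + 1) le_rfl
    have h2 : ζ 0 * ζ (m + 1) * ζ (m + 2) = 0 := by
      linear_combination ζ 0 * hclose - ζ 0 * heq + ζ 0 * ζ (m + 1) * hlast
    have h3 : ζ (m + 2) = 0 := by
      rcases mul_eq_zero.1 h2 with h2 | h2
      · exact absurd h2 (mul_ne_zero h0 hne)
      · exact h2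
    rw [show m + 1 + 1 = m + 2 from rfl, h3, zero_mul] at heq
    exact mul_ne_zero hne h1 heq.symm

theorem le_regularity_of_pathGraph [Finite V] {G : SimpleGraph V} {l : ℕ}
    (ι : SimpleGraph.pathGraph (l + 1) ↪g G) :
    (l : EReal) ≤ regularity (V ⊕ V) (quotientGrading (parityBinomialEdgeIdeal K G)) := by
  -- The variables sit at the indices `1, …, l`; the value `z 0 = 0` starts the successive
  -- vanishing.
  let z : ℕ → MvPolynomial (Fin l) K := fun i =>
    if h : 0 < i ∧ i < l + 1 then X ⟨i - 1, by omega⟩ else 0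
  have hz : ∀ i, z i ∈ Ideal.span (Set.range (X : Fin l → MvPolynomial (Fin l) K)) := by
    intro i
    simp only [z]
    split_ifs
    · exact Ideal.subset_span ⟨_, rfl⟩
    · exact zero_mem _
  refine le_regularity_of_embedding ι Fin.castSucc Fin.succ (fun j => ?_) (fun a b hab => ?_)
    (fun k => pathCoord z 0 (Even (k : ℕ)) k) (fun k => pathCoord z 0 (¬ Even (k : ℕ)) k)
    (fun k => pathCoord_mem hz _ _ _) (fun k => pathCoord_mem hz _ _ _) fun P hP h j => ?_
  · simp [SimpleGraph.pathGraph_adj]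
  · rw [SimpleGraph.pathGraph_adj] at hab
    rcases hab with hab | hab
    · exact ⟨⟨a, by omega⟩, Or.inl ⟨rfl, Fin.ext (by simpa using hab)⟩⟩
    · exact ⟨⟨b, by omega⟩, Or.inr ⟨rfl, Fin.ext (by simpa using hab)⟩⟩
  · have hζ := forall_eq_zero_of_sq_eq_mul (D := MvPolynomial (Fin l) K ⧸ P)
      (ζ := fun i => Ideal.Quotient.mk P (z i)) (l := l) (i₀ := 0) (by simp [z]) (by
        intro i hi _
        have := (pathCoord_edge_mem_iff z 0 i P).1 (h ⟨i, hi⟩)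
        rw [← Ideal.Quotient.eq_zero_iff_mem] at this
        simpa [sub_eq_zero] using this) (j + 1) j.2 (Nat.zero_le _)
    rw [← Ideal.Quotient.eq_zero_iff_mem]
    simpa [z] using hζ

theorem le_regularity_of_cycleGraph [Finite V] {G : SimpleGraph V} {n : ℕ} (hn : 3 ≤ n)
    (hodd : Odd n) (ι : SimpleGraph.cycleGraph n ↪g G) :
    (n : EReal) ≤ regularity (V ⊕ V) (quotientGrading (parityBinomialEdgeIdeal K G)) := by
  obtain ⟨m, rfl⟩ : ∃ m, n = m + 2 := ⟨n - 2, by omega⟩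
  -- Oddness of the cycle makes both ends `m + 1` and `0` of the closing edge even.
  have hm : Even (m + 1) := by
    rcases hodd with ⟨c, hc⟩
    exact ⟨c, by omega⟩
  -- The value at `m + 2` is the linear factor that the closing edge produces on a geometric
  -- progression when `γ = 1`.
  let z : ℕ → MvPolynomial (Fin (m + 2)) K := fun i =>
    if h : i < m + 2 then X ⟨i, h⟩ else 2 * X 1 - X 0
  have hz : ∀ i, z i ∈ Ideal.span (Set.range (X : Fin (m + 2) → MvPolynomial (Fin (m + 2)) K)) := by
    intro i
    simp only [z]
    split_ifs
    · exact Ideal.subset_span ⟨_, rfl⟩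
    · exact sub_mem (Ideal.mul_mem_left _ _ (Ideal.subset_span ⟨_, rfl⟩))
        (Ideal.subset_span ⟨_, rfl⟩)
  refine le_regularity_of_embedding ι id (fun j => j + 1) (fun j => ?_) (fun a b hab => ?_)
    (fun k => pathCoord z 1 (Even (k : ℕ)) k) (fun k => pathCoord z 1 (¬ Even (k : ℕ)) k)
    (fun k => pathCoord_mem hz _ _ _) (fun k => pathCoord_mem hz _ _ _) fun P hP h j => ?_
  · simp [SimpleGraph.cycleGraph_adj]
  · rw [SimpleGraph.cycleGraph_adj] at hab
    rcases hab with hab | hab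
    · exact ⟨b, Or.inr ⟨rfl, by rw [← hab, add_sub_cancel]⟩⟩
    · exact ⟨a, Or.inl ⟨rfl, by rw [← hab, add_sub_cancel]⟩⟩
  · have hζ := forall_eq_zero_of_cycle (D := MvPolynomial (Fin (m + 2)) K ⧸ P)
      (ζ := fun i => Ideal.Quotient.mk P (z i)) (m := m) (by omega) (by
        intro i hi
        have h1 := h ⟨i, by omega⟩
        have h2 : ((⟨i, by omega⟩ + 1 : Fin (m + 2)) : ℕ) = i + 1 := by
          rw [Fin.val_add_one_of_lt]
          rw [Fin.lt_def]
          simpa using hi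
        simp only [id, h2] at h1
        have := (pathCoord_edge_mem_iff z 1 i P).1 h1
        rw [← Ideal.Quotient.eq_zero_iff_mem] at this
        simpa [sub_eq_zero] using this)
      (by
        have h2 : Ideal.Quotient.mk P 2 = 2 := map_ofNat _ 2
        simp [z, h2]) (by
        -- With both ends even the closing binomial is `z (m+2) * z 1 - (z (m+1) - z (m+2)) * (z 0 -
        -- z 1)`.
        have h1 := h (Fin.last (m + 1))
        have hm' : ¬ Odd (m + 1) := by simpa using hm
        simp only [id, Fin.last_add_one, Fin.val_last, Fin.val_zero, pathCoord, hm, not_true,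
          if_true, if_false, Even.zero] at h1
        rw [← Ideal.Quotient.eq_zero_iff_mem] at h1
        rw [← h1]
        simp only [map_sub, map_mul, map_one]
        ring_nf) j (by omega)
    rw [← Ideal.Quotient.eq_zero_iff_mem]
    simpa [z] using hζ

/-- The number of vertices bounds the set, so the supremum is attained. The shift `c` is `1` for
paths, which have one more vertex than edges, and `0` for cycles. -/
theorem sSup_mem_of_isIndContained [Finite V] {G : SimpleGraph V} {s : Set ℕ} (hs : s.Nonempty)
    (H : ∀ k : ℕ, SimpleGraph (Fin k)) (c : ℕ) (h : ∀ k ∈ s, (H (k + c)).IsIndContained G) :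
    sSup s ∈ s := by
  refine Nat.sSup_mem hs ⟨Nat.card V, fun k hk => ?_⟩
  obtain ⟨ι⟩ := h k hk
  have := Nat.card_le_card_of_injective _ ι.injective
  simp at this
  omega

end ParityBinomialEdgeIdeal

end

theorem corollary3p6 {K : Type*} [Field K] {V : Type*} [Finite V] (G : SimpleGraph V)
    (hG : G.Connected) :
    ((max (longestInducedPath G) (longestInducedOddCycle G) : ℕ) : EReal) ≤
      regularity (V ⊕ V) (quotientGrading (parityBinomialEdgeIdeal K G)) := by
  have hpath : (longestInducedPath G : EReal) ≤
      regularity (V ⊕ V) (quotientGrading (parityBinomialEdgeIdeal K G)) := by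
    obtain ⟨v⟩ := hG.nonempty
    -- A single vertex is an induced path of length `0`.
    have hne : {k : ℕ | (SimpleGraph.pathGraph (k + 1)).IsIndContained G}.Nonempty :=
      ⟨0, ⟨⟨⟨fun _ => v, fun a b _ => Subsingleton.elim (α := Fin 1) a b⟩, by
        intro a b
        have : a = b := Subsingleton.elim (α := Fin 1) a b
        simp [this]⟩⟩⟩
    obtain ⟨ι⟩ := sSup_mem_of_isIndContained hne SimpleGraph.pathGraph 1 fun k hk => hk
    exact le_regularity_of_pathGraph ι
  rcases max_choice (longestInducedPath G) (longestInducedOddCycle G) with h | h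
  · rw [h]
    exact hpath
  · rw [h]
    rcases {k : ℕ | 3 ≤ k ∧ Odd k ∧
      (SimpleGraph.cycleGraph k).IsIndContained G}.eq_empty_or_nonempty with h0 | hne
    · rw [show longestInducedOddCycle G = 0 by rw [longestInducedOddCycle, h0, csSup_empty]; rfl]
      refine le_trans ?_ hpath
      exact_mod_cast Nat.zero_le _
    · obtain ⟨h3, hodd, ⟨ι⟩⟩ := sSup_mem_of_isIndContained hne SimpleGraph.cycleGraph 0
        fun k hk => hk.2.2
      exact le_regularity_of_cycleGraph h3 hodd ι
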